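/- **Setting.** Let $\mathcal A$ be a finite set of $k$ actions with reward distributions $P_a$ on $\mathbb R$ ($a\in\mathcal A$), means $\mu_a$, and gaps $\Delta_a=\max_b\mu_b-\mu_a$. Let $G$ be a connected undirected graph on the agents $V=\{1,\dots,m\}$, with graph distance $d_{vw}$. In every round $t=1,\dots,n$ each agent $w$ plays an action $A^w_t$ and observes a reward $X^w_t\sim P_{A^w_t}$; given the actions, rewards are independent over rounds and agents. Let $T_{aw}(n)$ be the number of rounds $t\le n$ with $A_t^w=a$; the group regret is $R_G(n)=\sum_a\Delta_a\,\mathbb E\big[\sum_{w}T_{aw}(n)\big]$. **Single-agent algorithm.** Let $\epsilon\in(0,1]$ and $\sigma$ be given. The truncated-mean robust upper confidence bound algorithm $\pi$ selects in its round $t$ an action $a$ maximising (ties broken by any measurable rule) the index $$B_a=\frac1s\sum_{i=1}^{s}x_i\,\mathbf 1\Big\{|x_i|\le\Big(\frac{\sigma i}{\ln t^2}\Big)^{\frac1{1+\epsilon}}\Big\}+4\,\sigma^{\frac1{1+\epsilon}}\Big(\frac{\ln t^2}{s}\Big)^{\frac{\epsilon}{1+\epsilon}},$$ where $x_1,\dots,x_s$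 are the rewards of $a$ fed to $\pi$ so far, in order; $B_a=+\infty$ if $s=0$. **QuACK with leader $v\in V$.** The leader keeps a first-in first-out queue of rewards for each action, initially empty. In round $t$ the leader first receives from each $w\ne v$ with $t>d_{vw}$ the pair $(A^w_{t-d_{vw}},X^w_{t-d_{vw}})$ and appends the reward to the queue of that action. As long as the action selected by $\pi$ has a non-empty queue, the first reward is removed from that queue and fed to $\pi$, which then selects again. Once $\pi$ selects an action with empty queue, the leader plays it and feeds the observed reward to $\pi$. Each agent $w\neq v$ plays $A^w_t=A^v_{t-d_{vw}}$ if $t>d_{vw}$, and an independent uniformly random action otherwise. **Statement.** For every $\epsilon\in(0,1]$ there is a constant $C>0$ depending only on $\epsilon$ such that the following holds for all $m,n$ with $mn\ge 2$, all connected $G$, all leaders $v\in V$, all $k$, all $\sigma$ and all reward distributions with $\mathbb E_{X\sim P_a}|X|^{1+\epsilon}\le\sigma$ for every $a\in\mathcal A$. Running QuACK with leader $v$ and the truncated-mean robust upper confidence bound algorithm with parameters $\epsilon,\sigma$ guarantees $$R_G(n)\le C\left(\sum_{a:\Delta_a>0}\frac{\sigma^{1/\epsilon}\ln(mn)}{\Delta_a^{1/\epsilon}}+\Big(\sum_{w=1}^m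 d_{vw}\Big)\sum_{a:\Delta_a>0}\Delta_a\right).$$ -/

import Mathlib

open MeasureTheory ProbabilityTheory

noncomputable section

namespace Quack

/-! ### Reward distributions -/

/-- Mean reward `μ_a` of action `a`. -/
def mean {k : ℕ} (ν : Fin k → Measure ℝ) (a : Fin k) : ℝ := ∫ x, x ∂(ν a)

/-- Sub-optimality gap `Δ_a = max_b μ_b - μ_a`. -/
def gap {k : ℕ} (ν : Fin k → Measure ℝ) (a : Fin k) : ℝ := (⨆ b, mean ν b) - mean ν a

/-- The sub-optimal actions. -/
def subopt {k : ℕ} (ν : Fin k → Measure ℝ) : Finset (Fin k) :=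
  open Classical in Finset.univ.filter fun a => 0 < gap ν a

/-! ### The truncated-mean robust upper confidence bound algorithm

A single-agent history is the chronological list of the (action, reward) pairs seen so far, and a
single-agent bandit algorithm maps each history to the next action. -/

/-- The rewards of action `a` in a history, in chronological order. -/
def samples {k : ℕ} (h : List (Fin k × ℝ)) (a : Fin k) : List ℝ :=
  h.filterMap fun p => if p.1 = a then some p.2 else none

/-- Truncated empirical mean at confidence level `δ`: the `i`-th sample (`i = 1, 2, …`) is kept if
its absolute value is at most `(σ i / ln (1/δ)) ^ (1/(1+ε))` and replaced by `0` otherwise. -/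
def truncatedMean (ε σ δ : ℝ) (xs : List ℝ) : ℝ :=
  (∑ i : Fin xs.length,
    if |xs[i]| ≤ (σ * ((i : ℕ) + 1 : ℝ) / Real.log (1 / δ)) ^ (1 / (1 + ε)) then xs[i] else 0)
      / xs.length

/-- Index of action `a` in round `t = h.length + 1`, with `δ = t⁻²`. It is `+∞` for an action without
samples; an action that has samples is only evaluated at some `t ≥ 2`. -/
def robustIndex {k : ℕ} (ε σ : ℝ) (h : List (Fin k × ℝ)) (a : Fin k) : EReal :=
  let xs := samples h a
  let t : ℝ := (h.length : ℝ) + 1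
  if xs.length = 0 then ⊤
  else ((truncatedMean ε σ (1 / t ^ 2) xs
    + 4 * σ ^ (1 / (1 + ε)) * (Real.log (t ^ 2) / xs.length) ^ (ε / (1 + ε)) : ℝ) : EReal)

/-- `π` is a truncated-mean robust UCB algorithm: it always selects an action of maximal index.
Ties may be broken in any way. -/
def IsRobustUCB {k : ℕ} (ε σ : ℝ) (π : List (Fin k × ℝ) → Fin k) : Prop :=
  ∀ h a, robustIndex ε σ h a ≤ robustIndex ε σ h (π h)

/-- Each choice is a measurable function of the past actions and rewards. -/
def MeasurablePolicy {k : ℕ} (π : List (Fin k × ℝ) → Fin k) : Prop :=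
  ∀ s : ℕ, Measurable fun h : Fin s → Fin k × ℝ => π (List.ofFn h)

/-! ### QuACK -/

/-- One pass of the leader's loop, on a pair (history of `π`, queues): if the queue of the action
selected by `π` is non-empty, its first reward is removed and fed to `π`. -/
def serve {k : ℕ} (π : List (Fin k × ℝ) → Fin k)
    (s : List (Fin k × ℝ) × (Fin k → List ℝ)) : List (Fin k × ℝ) × (Fin k → List ℝ) :=
  match s.2 (π s.1) with
  | [] => s
  | x :: xs => (s.1 ++ [(π s.1, x)], Function.update s.2 (π s.1) xs)

/-- Total number of queued rewards. -/
def queued {k : ℕ} (Q : Fin k → List ℝ) : ℕ := ∑ a, (Q a).length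

/-- The leader's loop, run until the selected action has an empty queue; as each effective pass
removes one reward, `queued` passes suffice (see `drain_empty`). -/
def drain {k : ℕ} (π : List (Fin k × ℝ) → Fin k)
    (s : List (Fin k × ℝ) × (Fin k → List ℝ)) : List (Fin k × ℝ) × (Fin k → List ℝ) :=
  (serve π)^[queued s.2] s

/-- State of the network between two rounds. -/
structure State (m k : ℕ) where
  /-- Actions and rewards of all agents in the completed rounds, most recent round first. -/
  log : List (Fin m → Fin k × ℝ)
  /-- Everything fed so far to the leader's single-agent algorithm, in chronological order. -/
  hist : List (Fin k × ℝ)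
  /-- The leader's queues, first-in first-out. -/
  queue : Fin k → List ℝ

/-- The state before the first round. -/
def State.init (m k : ℕ) : State m k := ⟨[], [], fun _ => []⟩

/-- What happened at all agents `d ≥ 1` rounds before the current one, if there was such a round. -/
def State.ago {m k : ℕ} (S : State m k) (d : ℕ) : Option (Fin m → Fin k × ℝ) := S.log[d - 1]?

/-- Messages that reach the leader `v` in the current round: from each follower `w`, the action and
reward of `w` from `d_{vw}` rounds ago. -/
def inbox {m k : ℕ} (G : SimpleGraph (Fin m)) (v : Fin m) (S : State m k) : List (Fin k × ℝ) :=
  (List.finRange m).filterMap fun w =>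
    if w = v then none else (S.ago (G.dist v w)).map fun r => r w

/-- One round of QuACK with leader `v`. Here `x w a` is the reward that agent `w` obtains in this
round if it plays `a`, and `u w` is the exploratory action of agent `w` in this round. -/
def step {m k : ℕ} (G : SimpleGraph (Fin m)) (v : Fin m) (π : List (Fin k × ℝ) → Fin k)
    (x : Fin m → Fin k → ℝ) (u : Fin m → Fin k) (S : State m k) : State m k :=
  let Q : Fin k → List ℝ := fun a => S.queue a ++ samples (inbox G v S) a
  let L := drain π (S.hist, Q)
  let act : Fin m → Fin k := fun w =>
    if w = v then π L.1
    else match S.ago (G.dist v w) with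
      | some r => (r v).1
      | none => u w
  let r : Fin m → Fin k × ℝ := fun w => (act w, x w (act w))
  ⟨r :: S.log, L.1 ++ [r v], L.2⟩

/-- The state after `n` rounds of QuACK. -/
def run {m k : ℕ} (G : SimpleGraph (Fin m)) (v : Fin m) (π : List (Fin k × ℝ) → Fin k)
    (x : ℕ → Fin m → Fin k → ℝ) (u : ℕ → Fin m → Fin k) : ℕ → State m k
  | 0 => State.init m k
  | n + 1 => step G v π (x n) (u n) (run G v π x u n)

/-- `T_{aw}(n)`: how often agent `w` plays action `a` in the first `n` rounds. -/
def plays {m k : ℕ} (G : SimpleGraph (Fin m)) (v : Fin m) (π : List (Fin k × ℝ) → Fin k)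
    (x : ℕ → Fin m → Fin k → ℝ) (u : ℕ → Fin m → Fin k) (n : ℕ) (w : Fin m) (a : Fin k) : ℕ :=
  (run G v π x u n).log.countP fun r => (r w).1 = a

/-- The randomness of the interaction: `X t w a` is the reward that agent `w` obtains in round `t`
if it plays `a`, of law `ν a`; `U t w` is the uniformly random action of agent `w` in round `t`, used
only while no instruction of the leader has arrived. All these variables are independent. -/
structure IsEnvironment {Ω : Type*} [MeasurableSpace Ω] (P : Measure Ω) {m k : ℕ}
    (ν : Fin k → Measure ℝ) (X : ℕ → Fin m → Fin k → Ω → ℝ) (U : ℕ → Fin m → Ω → Fin k) :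
    Prop where
  measurable_reward : ∀ t w a, Measurable (X t w a)
  map_reward : ∀ t w a, P.map (X t w a) = ν a
  measurable_explore : ∀ t w, Measurable (U t w)
  uniform_explore : ∀ t w a, P {ω | U t w ω = a} = (k : ENNReal)⁻¹
  indep_reward : iIndepFun (fun i : ℕ × Fin m × Fin k => X i.1 i.2.1 i.2.2) P
  indep_explore : iIndepFun (fun i : ℕ × Fin m => U i.1 i.2) P
  indep : IndepFun (fun ω (i : ℕ × Fin m × Fin k) => X i.1 i.2.1 i.2.2 ω)
    (fun ω (i : ℕ × Fin m) => U i.1 i.2 ω) P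

/-- Group regret `R_G(n) = ∑_a Δ_a E[∑_w T_{aw}(n)]` of QuACK with leader `v` and single-agent
algorithm `π`. -/
def groupRegret {Ω : Type*} [MeasurableSpace Ω] (P : Measure Ω) {m k : ℕ}
    (ν : Fin k → Measure ℝ) (X : ℕ → Fin m → Fin k → Ω → ℝ) (U : ℕ → Fin m → Ω → Fin k)
    (G : SimpleGraph (Fin m)) (v : Fin m) (π : List (Fin k × ℝ) → Fin k) (n : ℕ) : ℝ :=
  ∑ a, gap ν a *
    ∫ ω, ∑ w, (plays G v π (fun t w a => X t w a ω) (fun t w => U t w ω) n w a : ℝ) ∂P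

theorem iterate_serve_empty {k : ℕ} (π : List (Fin k × ℝ) → Fin k) (N : ℕ) :
    ∀ s : List (Fin k × ℝ) × (Fin k → List ℝ), queued s.2 ≤ N →
      ((serve π)^[N] s).2 (π ((serve π)^[N] s).1) = [] := by
  induction N with
  | zero =>
    intro s hs
    have h0 : (s.2 (π s.1)).length ≤ queued s.2 :=
      Finset.single_le_sum (f := fun a => (s.2 a).length) (fun _ _ => Nat.zero_le _)
        (Finset.mem_univ (π s.1))
    exact List.eq_nil_of_length_eq_zero (by simp only [Function.iterate_zero, id]; omega)
  | succ N ih =>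
    intro s hs
    rw [Function.iterate_succ_apply]
    rcases hq : s.2 (π s.1) with _ | ⟨x, xs⟩
    · have h1 : serve π s = s := by simp [serve, hq]
      have h2 : ∀ j, (serve π)^[j] s = s := fun j => Function.iterate_fixed h1 j
      rw [h1, h2 N, hq]
    · apply ih
      have h1 : serve π s = (s.1 ++ [(π s.1, x)], Function.update s.2 (π s.1) xs) := by
        simp [serve, hq]
      rw [h1]
      have h2 : queued (Function.update s.2 (π s.1) xs) < queued s.2 := by
        apply Finset.sum_lt_sum
        · intro b _
          by_cases hb : b = π s.1
          · subst hb; simp [hq]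
          · simp [Function.update_of_ne hb]
        · exact ⟨π s.1, Finset.mem_univ _, by simp [hq]⟩
      simp only
      omega

/-- When the leader's loop ends, the queue of the selected action is empty. -/
theorem drain_empty {k : ℕ} (π : List (Fin k × ℝ) → Fin k)
    (s : List (Fin k × ℝ) × (Fin k → List ℝ)) : (drain π s).2 (π (drain π s).1) = [] :=
  iterate_serve_empty π _ s le_rfl

end Quack

end

/-!
The rewards that an action produces at the slots (round, agent) already reported to the leader are
served first-in first-out, so the samples of the single-agent algorithm are, in order, an initial
segment of those rewards. The report order makes the decision to play an action at a slot a function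
of the rewards at earlier slots, hence independent of the reward at that slot: each exponential
tilt of the truncated rewards has conditional mean at most `1`, and the product of the tilts over
any number of arrivals is a supermartingale. Markov's inequality bounds every confidence failure as
if the samples were i.i.d., although delays and queues correlate their number with their values.

Outside these failures the algorithm selects a suboptimal action only until its width falls below
the gap. When the leader plays that action for the last time, its queue is empty, so everything
reported so far has been consumed. What a follower at distance `d` plays beyond that lies in `2 * d`
rounds: `d` whose reports are still under way and `d` in which it carries out older instructions.
-/

noncomputable section

namespace Quack

/-! ### Truncated means of heavy-tailed samples -/

section Truncation

/-- `ν` has a finite absolute moment of order `1 + ε`, bounded by `σ`. -/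
structure MomentBound (ν : Measure ℝ) (ε σ : ℝ) : Prop where
  integrable : Integrable (fun x : ℝ => |x| ^ (1 + ε)) ν
  integral_le : ∫ x, |x| ^ (1 + ε) ∂ν ≤ σ

/-- Truncation at level `B`: values beyond `B` are replaced by `0`. -/
def trunc (B x : ℝ) : ℝ := if |x| ≤ B then x else 0

theorem measurable_trunc (B : ℝ) : Measurable (trunc B) :=
  measurable_id.ite (measurableSet_le measurable_abs measurable_const) measurable_const

theorem abs_trunc_le {B : ℝ} (hB : 0 ≤ B) (x : ℝ) : |trunc B x| ≤ B := by
  unfold trunc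
  split_ifs with h
  · exact h
  · simpa using hB

theorem integrable_trunc {ν : Measure ℝ} [IsFiniteMeasure ν] {B : ℝ} (hB : 0 ≤ B) :
    Integrable (trunc B) ν :=
  .of_bound (measurable_trunc B).aestronglyMeasurable B (.of_forall (abs_trunc_le hB))

theorem abs_sub_trunc_le {B ε : ℝ} (hB : 0 < B) (hε : 0 ≤ ε) (x : ℝ) :
    |x - trunc B x| ≤ |x| ^ (1 + ε) / B ^ ε := by
  unfold trunc
  split_ifs with h
  · simp only [sub_self, abs_zero]
    positivity
  · have hBx : B < |x| := not_le.1 h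
    have hx : 0 < |x| := hB.trans hBx
    rw [sub_zero, le_div_iff₀ (by positivity), Real.rpow_add hx, Real.rpow_one]
    gcongr

theorem trunc_sq_le {B ε : ℝ} (hB : 0 ≤ B) (hε : ε ≤ 1) (x : ℝ) :
    trunc B x ^ 2 ≤ |x| ^ (1 + ε) * B ^ (1 - ε) := by
  rcases eq_or_ne (trunc B x) 0 with h0 | h0
  · rw [h0, zero_pow two_ne_zero]
    positivity
  · have hxB : |x| ≤ B := by
      by_contra hx
      exact h0 (if_neg hx)
    have htrunc : trunc B x = x := if_pos hxB
    have hx : 0 < |x| := abs_pos.2 (htrunc ▸ h0)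
    calc trunc B x ^ 2 = |x| ^ (1 + ε) * |x| ^ (1 - ε) := by
          rw [htrunc, ← Real.rpow_add hx, ← sq_abs, ← Real.rpow_natCast]
          norm_num
      _ ≤ |x| ^ (1 + ε) * B ^ (1 - ε) := by
          gcongr

namespace MomentBound

variable {ν : Measure ℝ} {ε σ B : ℝ}

theorem integrable_id [IsFiniteMeasure ν] (h : MomentBound ν ε σ) (hε : 0 ≤ ε) :
    Integrable (fun x : ℝ => x) ν := by
  have hp : 0 < 1 + ε := by positivity
  have hmem : MemLp id (ENNReal.ofReal (1 + ε)) ν := by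
    rw [← integrable_norm_rpow_iff aestronglyMeasurable_id (ENNReal.ofReal_pos.2 hp).ne'
      ENNReal.ofReal_ne_top, ENNReal.toReal_ofReal hp.le]
    exact h.integrable
  exact hmem.integrable (ENNReal.one_le_ofReal.2 (by linarith))

theorem abs_integral_trunc_sub_le [IsFiniteMeasure ν] (h : MomentBound ν ε σ) (hε : 0 ≤ ε)
    (hB : 0 < B) : |(∫ x, trunc B x ∂ν) - ∫ x, x ∂ν| ≤ σ / B ^ ε := by
  rw [abs_sub_comm, ← integral_sub (h.integrable_id hε) (integrable_trunc hB.le)]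
  calc |∫ x, (x - trunc B x) ∂ν| ≤ ∫ x, |x - trunc B x| ∂ν := abs_integral_le_integral_abs
    _ ≤ ∫ x, |x| ^ (1 + ε) / B ^ ε ∂ν :=
        integral_mono_of_nonneg (.of_forall fun x => abs_nonneg _) (h.integrable.div_const _)
          (.of_forall (abs_sub_trunc_le hB hε))
    _ = (∫ x, |x| ^ (1 + ε) ∂ν) / B ^ ε := integral_div _ _
    _ ≤ σ / B ^ ε := by
        gcongr
        exact h.integral_le

theorem integral_trunc_sq_le (h : MomentBound ν ε σ) (hε : ε ≤ 1) (hB : 0 ≤ B) :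
    ∫ x, trunc B x ^ 2 ∂ν ≤ σ * B ^ (1 - ε) := by
  calc ∫ x, trunc B x ^ 2 ∂ν ≤ ∫ x, |x| ^ (1 + ε) * B ^ (1 - ε) ∂ν :=
        integral_mono_of_nonneg (.of_forall fun x => sq_nonneg _) (h.integrable.mul_const _)
          (.of_forall (trunc_sq_le hB hε))
    _ = (∫ x, |x| ^ (1 + ε) ∂ν) * B ^ (1 - ε) := integral_mul_const _ _
    _ ≤ σ * B ^ (1 - ε) := by
        gcongr
        exact h.integral_le

theorem abs_integral_le [IsProbabilityMeasure ν] (h : MomentBound ν ε σ) (hε : 0 < ε) :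
    |∫ x, x ∂ν| ≤ σ ^ (1 / (1 + ε)) := by
  have hp : 0 < 1 + ε := by positivity
  have hjensen : (∫ x, |x| ∂ν) ^ (1 + ε) ≤ ∫ x, |x| ^ (1 + ε) ∂ν :=
    (convexOn_rpow (by linarith)).map_integral_le
      (continuousOn_id.rpow_const fun _ _ => .inr hp.le) isClosed_Ici
      (.of_forall fun x => abs_nonneg x) (h.integrable_id hε.le).abs h.integrable
  calc |∫ x, x ∂ν| ≤ ∫ x, |x| ∂ν := abs_integral_le_integral_abs
    _ = ((∫ x, |x| ∂ν) ^ (1 + ε)) ^ (1 / (1 + ε)) := by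
        rw [one_div, Real.rpow_rpow_inv (integral_nonneg fun x => abs_nonneg x) hp.ne']
    _ ≤ σ ^ (1 / (1 + ε)) := by
        gcongr
        exact hjensen.trans h.integral_le

end MomentBound

end Truncation

section Level

/-- The truncation level `(σ r / L) ^ (1 / (1 + ε))` of the `r`-th sample, counted from `1`, at
confidence `L = log (1 / δ)`. -/
def level (ε σ L r : ℝ) : ℝ := (σ * r / L) ^ (1 / (1 + ε))

/-- A quarter of the exploration bonus after `r` samples at confidence `L = log (1 / δ)`. -/
def width (ε σ L r : ℝ) : ℝ := σ ^ (1 / (1 + ε)) * (L / r) ^ (ε / (1 + ε))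

theorem sub_one_div_one_add {ε : ℝ} (hε : 0 < 1 + ε) : 1 / (1 + ε) - 1 = -(ε / (1 + ε)) := by
  field_simp
  ring

variable {ε σ L r : ℝ}

theorem level_pos (hσ : 0 < σ) (hL : 0 < L) (hr : 0 < r) : 0 < level ε σ L r := by
  unfold level
  positivity

theorem level_le_level (hε : 0 ≤ 1 + ε) (hσ : 0 ≤ σ) (hL : 0 ≤ L) (hr : 0 ≤ r) {r' : ℝ}
    (h : r ≤ r') : level ε σ L r ≤ level ε σ L r' := by
  unfold level
  gcongr

theorem level_rpow (hε : 0 < 1 + ε) (hσ : 0 ≤ σ) (hL : 0 ≤ L) (hr : 0 ≤ r) :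
    level ε σ L r ^ (1 + ε) = σ * r / L := by
  rw [level, one_div, Real.rpow_inv_rpow (by positivity) hε.ne']

theorem width_eq_level_mul (hε : 0 < 1 + ε) (hσ : 0 ≤ σ) (hL : 0 < L) (hr : 0 < r) :
    width ε σ L r = level ε σ L r * (L / r) := by
  have hLr : 0 < L / r := by positivity
  have hlevel : level ε σ L r = σ ^ (1 / (1 + ε)) * (L / r) ^ (-(1 / (1 + ε))) := by
    rw [level, Real.rpow_neg hLr.le, ← Real.inv_rpow hLr.le, ← Real.mul_rpow hσ (by positivity),
      inv_div, mul_div_assoc]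
  have hexp : -(1 / (1 + ε)) + 1 = ε / (1 + ε) := by
    linarith [sub_one_div_one_add hε]
  rw [hlevel, mul_assoc, ← Real.rpow_add_one hLr.ne', hexp, width]

theorem div_level_rpow (hε : 0 < 1 + ε) (hσ : 0 < σ) (hL : 0 < L) (hr : 0 < r) :
    σ / level ε σ L r ^ ε = width ε σ L r := by
  have hB := level_pos (ε := ε) hσ hL hr
  have hpow := level_rpow hε hσ.le hL.le hr.le
  rw [Real.rpow_add hB, Real.rpow_one] at hpow
  rw [width_eq_level_mul hε hσ.le hL hr, div_eq_iff (by positivity)]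
  calc σ = (σ * r / L) * (L / r) := by field_simp
    _ = level ε σ L r * (L / r) * level ε σ L r ^ ε := by rw [← hpow]; ring

theorem mul_add_one_rpow_sub_one_le {q x : ℝ} (hq0 : 0 ≤ q) (hq1 : q ≤ 1) (hx : 0 ≤ x) :
    q * (x + 1) ^ (q - 1) ≤ (x + 1) ^ q - x ^ q := by
  have hx1 : 0 < x + 1 := by positivity
  have hbernoulli := rpow_one_add_le_one_add_mul_self (s := -1 / (x + 1)) (p := q)
    (by rw [le_div_iff₀ hx1]; linarith) hq0 hq1
  have hratio : 1 + -1 / (x + 1) = x / (x + 1) := by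
    field_simp
    ring
  rw [hratio, Real.div_rpow hx hx1.le, div_le_iff₀ (by positivity)] at hbernoulli
  rw [Real.rpow_sub_one hx1.ne']
  linear_combination hbernoulli

theorem mul_sum_rpow_sub_one_le {q : ℝ} (hq0 : 0 < q) (hq1 : q ≤ 1) (s : ℕ) :
    q * ∑ i ∈ Finset.range s, ((i : ℝ) + 1) ^ (q - 1) ≤ (s : ℝ) ^ q := by
  rw [Finset.mul_sum]
  refine (Finset.sum_le_sum fun i _ =>
    mul_add_one_rpow_sub_one_le hq0.le hq1 i.cast_nonneg).trans_eq ?_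
  have htelescope := Finset.sum_range_sub (fun i : ℕ => (i : ℝ) ^ q) s
  simpa [Real.zero_rpow hq0.ne'] using htelescope

theorem sum_width_le (hε : 0 ≤ ε) (hσ : 0 ≤ σ) (hL : 0 ≤ L) (s : ℕ) :
    ∑ i ∈ Finset.range s, width ε σ L (i + 1) ≤ (1 + ε) * (s * width ε σ L s) := by
  set q := 1 / (1 + ε)
  have hε' : 0 < 1 + ε := by positivity
  have hq1 : q ≤ 1 := (div_le_one hε').2 (by linarith)
  have hwidth : ∀ r : ℝ, 0 ≤ r →
      width ε σ L r = σ ^ q * L ^ (ε / (1 + ε)) * r ^ (q - 1) := fun r hr => by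
    rw [width, Real.div_rpow hL hr, sub_one_div_one_add hε', Real.rpow_neg hr]
    ring
  have hs : (s : ℝ) * (s : ℝ) ^ (q - 1) = (s : ℝ) ^ q := by
    rcases s.eq_zero_or_pos with rfl | hs
    · rw [Nat.cast_zero, zero_mul, Real.zero_rpow (by positivity)]
    · rw [mul_comm, ← Real.rpow_add_one (by positivity), sub_add_cancel]
  have hqε : (1 + ε) * q = 1 := mul_one_div_cancel hε'.ne'
  calc ∑ i ∈ Finset.range s, width ε σ L (i + 1)
      = σ ^ q * L ^ (ε / (1 + ε)) * ((1 + ε) * (q * ∑ i ∈ Finset.range s,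
          ((i : ℝ) + 1) ^ (q - 1))) := by
        rw [← mul_assoc (1 + ε), hqε, one_mul, Finset.mul_sum]
        exact Finset.sum_congr rfl fun i _ => hwidth _ (by positivity)
    _ ≤ σ ^ q * L ^ (ε / (1 + ε)) * ((1 + ε) * (s : ℝ) ^ q) := by
        gcongr
        exact mul_sum_rpow_sub_one_le (by positivity) hq1 s
    _ = (1 + ε) * (s * width ε σ L s) := by
        rw [hwidth s s.cast_nonneg, ← hs]
        ring

end Level

section ExponentialWeight

theorem lintegral_exp_sub_integral_le_one {Ω : Type*} [MeasurableSpace Ω] {μ : Measure Ω}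
    [IsProbabilityMeasure μ] {Z : Ω → ℝ} {V : ℝ} (hZ : AEStronglyMeasurable Z μ)
    (hbound : ∀ ω, |Z ω| ≤ 1) (hV : ∫ ω, Z ω ^ 2 ∂μ ≤ V) :
    ∫⁻ ω, ENNReal.ofReal (Real.exp (Z ω - ∫ ω', Z ω' ∂μ - V)) ∂μ ≤ 1 := by
  set c := ∫ ω, Z ω ∂μ with hc
  have hint : Integrable Z μ := .of_bound hZ 1 (.of_forall hbound)
  have hsq : Integrable (fun ω => Z ω ^ 2) μ := .of_bound (hZ.pow 2) 1 (.of_forall fun ω => by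
    simpa using hbound ω)
  have hexp : ∀ ω, Real.exp (Z ω) ≤ 1 + Z ω + Z ω ^ 2 := fun ω => by
    linarith [(abs_le.1 (Real.abs_exp_sub_one_sub_id_le (hbound ω))).2]
  have hlin : Integrable (fun ω => 1 + Z ω) μ := (integrable_const 1).add hint
  have hquad : Integrable (fun ω => 1 + Z ω + Z ω ^ 2) μ := hlin.add hsq
  calc ∫⁻ ω, ENNReal.ofReal (Real.exp (Z ω - c - V)) ∂μ
      ≤ ∫⁻ ω, ENNReal.ofReal (Real.exp (-(c + V)) * (1 + Z ω + Z ω ^ 2)) ∂μ := by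
        gcongr with ω
        rw [show Z ω - c - V = -(c + V) + Z ω by ring, Real.exp_add]
        gcongr
        exact hexp ω
    _ = ENNReal.ofReal (Real.exp (-(c + V)) * (1 + c + ∫ ω, Z ω ^ 2 ∂μ)) := by
        rw [← ofReal_integral_eq_lintegral_ofReal (hquad.const_mul _) (.of_forall fun ω =>
            mul_nonneg (Real.exp_pos _).le ((Real.exp_pos _).le.trans (hexp ω))),
          integral_const_mul, integral_add hlin hsq,
          integral_add (integrable_const 1) hint]
        simp [hc]
    _ ≤ ENNReal.ofReal (Real.exp (-(c + V)) * Real.exp (c + V)) := by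
        gcongr
        linarith [Real.add_one_le_exp (c + V)]
    _ = 1 := by
        rw [← Real.exp_add, neg_add_cancel, Real.exp_zero, ENNReal.ofReal_one]

/-- The product of the weights `f i` at the entries of a list. -/
def weight (f : ℕ → ℝ → ENNReal) (xs : List ℝ) : ENNReal :=
  ∏ i ∈ Finset.range xs.length, f i (xs.getD i 0)

theorem weight_append_singleton (f : ℕ → ℝ → ENNReal) (xs : List ℝ) (y : ℝ) :
    weight f (xs ++ [y]) = weight f xs * f xs.length y := by
  unfold weight
  rw [List.length_append, List.length_singleton, Finset.prod_range_succ]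
  congr 1
  · refine Finset.prod_congr rfl fun i hi => ?_
    rw [List.getD_append _ _ _ _ (Finset.mem_range.1 hi)]
  · simp

/-- The factor contributed by the sample `x` in position `i` to the exponential weight that detects
a deviation of the truncated mean of the first `s` samples, upwards for `κ = 1` and downwards for
`κ = -1`. It has mean at most one under `ν`. -/
def deviationWeight (ν : Measure ℝ) (ε σ L κ : ℝ) (s i : ℕ) (x : ℝ) : ENNReal :=
  if i < s then ENNReal.ofReal (Real.exp (κ / level ε σ L s * trunc (level ε σ L (i + 1)) x
    - (∫ y, κ / level ε σ L s * trunc (level ε σ L (i + 1)) y ∂ν) - L / s))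
  else 1

theorem measurable_deviationWeight (ν : Measure ℝ) (ε σ L κ : ℝ) (s i : ℕ) :
    Measurable (deviationWeight ν ε σ L κ s i) := by
  unfold deviationWeight
  split_ifs
  · exact ((((measurable_trunc _).const_mul _).sub_const _).sub_const _).exp.ennreal_ofReal
  · exact measurable_const

variable {ν : Measure ℝ} {ε σ L κ : ℝ}

theorem lintegral_deviationWeight_le_one [IsProbabilityMeasure ν] (h : MomentBound ν ε σ)
    (hε : 0 < ε) (hε1 : ε ≤ 1) (hσ : 0 < σ) (hL : 0 < L) (hκ : |κ| = 1) (s i : ℕ) :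
    ∫⁻ x, deviationWeight ν ε σ L κ s i x ∂ν ≤ 1 := by
  unfold deviationWeight
  split_ifs with his
  swap
  · simp
  have hs : (0 : ℝ) < s := by exact_mod_cast i.zero_le.trans_lt his
  have hB : 0 < level ε σ L s := level_pos hσ hL hs
  have hBi : 0 < level ε σ L (i + 1) := level_pos hσ hL (by positivity)
  have hle : level ε σ L (i + 1) ≤ level ε σ L s :=
    level_le_level (by positivity) hσ.le hL.le (by positivity) (by exact_mod_cast his)
  refine lintegral_exp_sub_integral_le_one
    ((measurable_trunc _).const_mul _).aestronglyMeasurable (fun x => ?_) ?_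
  · rw [abs_mul, abs_div, hκ, abs_of_pos hB, one_div, inv_mul_le_iff₀ hB, mul_one]
    exact (abs_trunc_le hBi.le x).trans hle
  · have hsplit : level ε σ L s ^ 2 = σ * s / L * level ε σ L s ^ (1 - ε) := by
      rw [← level_rpow (by positivity) hσ.le hL.le hs.le, ← Real.rpow_add hB,
        ← Real.rpow_natCast]
      norm_num
    simp only [mul_pow, div_pow, ← sq_abs κ, hκ, one_pow, integral_const_mul]
    calc 1 / level ε σ L s ^ 2 * ∫ x, trunc (level ε σ L (i + 1)) x ^ 2 ∂ν
        ≤ 1 / level ε σ L s ^ 2 * (σ * level ε σ L s ^ (1 - ε)) := by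
          gcongr
          refine (h.integral_trunc_sq_le hε1 hBi.le).trans ?_
          gcongr
      _ = L / s := by
          rw [hsplit]
          field_simp

theorem weight_deviationWeight {s : ℕ} (hs : s ≠ 0) {xs : List ℝ} (hlen : s ≤ xs.length) :
    weight (deviationWeight ν ε σ L κ s) xs = ENNReal.ofReal (Real.exp (κ / level ε σ L s *
      ((∑ i ∈ Finset.range s, trunc (level ε σ L (i + 1)) (xs.getD i 0))
        - ∑ i ∈ Finset.range s, ∫ y, trunc (level ε σ L (i + 1)) y ∂ν) - L)) := by
  unfold weight deviationWeight
  rw [← Finset.prod_subset (Finset.range_subset_range.2 hlen) fun i _ hi =>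
      if_neg (Finset.mem_range.not.1 hi),
    Finset.prod_congr rfl fun i hi => if_pos (Finset.mem_range.1 hi),
    ← ENNReal.ofReal_prod_of_nonneg fun i _ => (Real.exp_pos _).le, ← Real.exp_sum]
  simp only [Finset.sum_sub_distrib, integral_const_mul, ← Finset.mul_sum, mul_sub,
    Finset.sum_const, Finset.card_range, nsmul_eq_mul]
  rw [mul_div_cancel₀ L (Nat.cast_ne_zero.2 hs)]

theorem MomentBound.abs_sum_integral_trunc_sub_le [IsFiniteMeasure ν] (h : MomentBound ν ε σ)
    (hε : 0 < ε) (hσ : 0 < σ) (hL : 0 < L) (s : ℕ) :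
    |(∑ i ∈ Finset.range s, ∫ y, trunc (level ε σ L (i + 1)) y ∂ν) - s * ∫ x, x ∂ν|
      ≤ (1 + ε) * (s * width ε σ L s) := by
  calc |(∑ i ∈ Finset.range s, ∫ y, trunc (level ε σ L (i + 1)) y ∂ν) - s * ∫ x, x ∂ν|
      = |∑ i ∈ Finset.range s, ((∫ y, trunc (level ε σ L (i + 1)) y ∂ν) - ∫ x, x ∂ν)| := by
        rw [Finset.sum_sub_distrib, Finset.sum_const, Finset.card_range, nsmul_eq_mul]
    _ ≤ ∑ i ∈ Finset.range s, |(∫ y, trunc (level ε σ L (i + 1)) y ∂ν) - ∫ x, x ∂ν| :=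
        Finset.abs_sum_le_sum_abs _ _
    _ ≤ ∑ i ∈ Finset.range s, width ε σ L (i + 1) := by
        gcongr with i
        have hi : (0 : ℝ) < i + 1 := by positivity
        rw [← div_level_rpow (by positivity) hσ hL hi]
        exact h.abs_integral_trunc_sub_le hε.le (level_pos hσ hL hi)
    _ ≤ (1 + ε) * (s * width ε σ L s) := sum_width_le hε.le hσ.le hL.le s

theorem truncatedMean_eq_sum_range (ε σ δ : ℝ) (xs : List ℝ) :
    truncatedMean ε σ δ xs = (∑ i ∈ Finset.range xs.length,
      trunc (level ε σ (Real.log (1 / δ)) (i + 1)) (xs.getD i 0)) / xs.length := by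
  unfold truncatedMean trunc level
  rw [Finset.sum_range]
  simp

theorem truncatedMean_take {ε σ δ : ℝ} {s : ℕ} {xs : List ℝ} (hlen : s ≤ xs.length) :
    truncatedMean ε σ δ (xs.take s) = (∑ i ∈ Finset.range s,
      trunc (level ε σ (Real.log (1 / δ)) (i + 1)) (xs.getD i 0)) / s := by
  rw [truncatedMean_eq_sum_range, List.length_take_of_le hlen]
  congr 1
  refine Finset.sum_congr rfl fun i hi => ?_
  rw [List.getD_eq_getElem?_getD, List.getElem?_take_of_lt (Finset.mem_range.1 hi),
    ← List.getD_eq_getElem?_getD]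

/-- The bias of the truncated mean is at most `2 * width`, so a deviation by the full bonus leaves a
fluctuation of at least `2 * width` around the truncated expectations. -/
theorem MomentBound.one_div_le_weight_of_deviation [IsFiniteMeasure ν]
    (h : MomentBound ν ε σ) (hε : 0 < ε) (hε1 : ε ≤ 1) (hσ : 0 < σ) (hκ : |κ| = 1)
    {δ : ℝ} (hδ0 : 0 < δ) (hδ1 : δ < 1) {s : ℕ} (hs : s ≠ 0) {xs : List ℝ} (hlen : s ≤ xs.length)
    (hdev : 4 * width ε σ (Real.log (1 / δ)) s
      ≤ κ * (truncatedMean ε σ δ (xs.take s) - ∫ x, x ∂ν)) :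
    ENNReal.ofReal (1 / δ) ≤ weight (deviationWeight ν ε σ (Real.log (1 / δ)) κ s) xs := by
  rw [truncatedMean_take hlen] at hdev
  set L := Real.log (1 / δ)
  set μ := ∫ x, x ∂ν
  set S := ∑ i ∈ Finset.range s, trunc (level ε σ L (i + 1)) (xs.getD i 0)
  set E := ∑ i ∈ Finset.range s, ∫ y, trunc (level ε σ L (i + 1)) y ∂ν
  have hL : 0 < L := Real.log_pos ((one_lt_div hδ0).2 hδ1)
  have hs0 : (0 : ℝ) < s := by positivity
  have hB : 0 < level ε σ L s := level_pos hσ hL hs0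
  have hwidth : s * width ε σ L s = level ε σ L s * L := by
    rw [width_eq_level_mul (by positivity) hσ.le hL hs0]
    field_simp
  have hbias : κ * (E - s * μ) ≤ 2 * (level ε σ L s * L) := by
    refine (le_abs_self _).trans ?_
    rw [abs_mul, hκ, one_mul, ← hwidth]
    refine (h.abs_sum_integral_trunc_sub_le hε hσ hL s).trans ?_
    rw [hwidth]
    gcongr
    linarith
  have htotal : 4 * (level ε σ L s * L) ≤ κ * (S - s * μ) := by
    calc 4 * (level ε σ L s * L) = s * (4 * width ε σ L s) := by rw [← hwidth]; ring
      _ ≤ s * (κ * (S / s - μ)) := by gcongr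
      _ = κ * (S - s * μ) := by field_simp
  have hfluct : 2 * L ≤ κ / level ε σ L s * (S - E) := by
    rw [div_mul_eq_mul_div, le_div_iff₀ hB]
    linear_combination htotal + hbias
  calc ENNReal.ofReal (1 / δ) = ENNReal.ofReal (Real.exp L) := by
        rw [Real.exp_log (one_div_pos.2 hδ0)]
    _ ≤ ENNReal.ofReal (Real.exp (κ / level ε σ L s * (S - E) - L)) := by
        gcongr
        linarith
    _ = weight (deviationWeight ν ε σ L κ s) xs := (weight_deviationWeight hs hlen).symm

end ExponentialWeight

/-! ### The leader's loop on arbitrary payloads -/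

section Payload

variable {k : ℕ} {β : Type*}

/-- `samples` for histories with arbitrary payloads in place of the rewards. -/
def tagSamples (h : List (Fin k × β)) (a : Fin k) : List β :=
  h.filterMap fun p => if p.1 = a then some p.2 else none

theorem tagSamples_append (h h' : List (Fin k × β)) (a : Fin k) :
    tagSamples (h ++ h') a = tagSamples h a ++ tagSamples h' a :=
  List.filterMap_append

theorem tagSamples_singleton (b : Fin k) (y : β) (a : Fin k) :
    tagSamples [(b, y)] a = if b = a then [y] else [] := by
  by_cases h : b = a <;> simp [tagSamples, h]

theorem mem_tagSamples {h : List (Fin k × β)} {a : Fin k} {y : β} :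
    y ∈ tagSamples h a ↔ (a, y) ∈ h := by
  simp [tagSamples, List.mem_filterMap, and_comm]

theorem tagSamples_map_graph (A : β → Fin k) (l : List β) (a : Fin k) :
    tagSamples (l.map fun e => (A e, e)) a = l.filter fun e => A e = a := by
  rw [tagSamples, List.filterMap_map, ← List.filterMap_eq_filter]
  congr 1
  funext e
  simp [Option.guard]

theorem sum_length_tagSamples (h : List (Fin k × β)) :
    ∑ a, (tagSamples h a).length = h.length := by
  induction h using List.reverseRecOn with
  | nil => simp [tagSamples]
  | append_singleton h p ih =>
    obtain ⟨b, y⟩ := p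
    simp only [tagSamples_append, tagSamples_singleton, List.length_append, Finset.sum_add_distrib,
      ih, apply_ite List.length, List.length_singleton, List.length_nil, Finset.sum_ite_eq,
      Finset.mem_univ, if_true]

/-- `serve` for histories and queues with arbitrary payloads. -/
def tagServe (ρ : List (Fin k × β) → Fin k)
    (s : List (Fin k × β) × (Fin k → List β)) : List (Fin k × β) × (Fin k → List β) :=
  match s.2 (ρ s.1) with
  | [] => s
  | y :: ys => (s.1 ++ [(ρ s.1, y)], Function.update s.2 (ρ s.1) ys)

/-- `drain` for histories and queues with arbitrary payloads. -/
def tagDrain (ρ : List (Fin k × β) → Fin k)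
    (s : List (Fin k × β) × (Fin k → List β)) : List (Fin k × β) × (Fin k → List β) :=
  (tagServe ρ)^[∑ a, (s.2 a).length] s

/-- Every action in the history is the one that `ρ` selects on the history before it. -/
def Follows (ρ : List (Fin k × β) → Fin k) (h : List (Fin k × β)) : Prop :=
  ∀ l p, l ++ [p] <+: h → p.1 = ρ l

theorem Follows.append {ρ : List (Fin k × β) → Fin k} {h : List (Fin k × β)} (hh : Follows ρ h)
    (y : β) : Follows ρ (h ++ [(ρ h, y)]) := by
  intro l p hl
  rcases List.prefix_concat_iff.1 hl with heq | hl
  · obtain ⟨rfl, rfl⟩ : l = h ∧ p = (ρ h, y) := by simpa using heq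
    rfl
  · exact hh l p hl

theorem tagServe_induction {ρ : List (Fin k × β) → Fin k}
    {C : List (Fin k × β) × (Fin k → List β) → Prop}
    (hC : ∀ h Q y ys, Q (ρ h) = y :: ys → C (h, Q) →
      C (h ++ [(ρ h, y)], Function.update Q (ρ h) ys))
    {s : List (Fin k × β) × (Fin k → List β)} (hs : C s) : C (tagServe ρ s) := by
  unfold tagServe
  split
  · exact hs
  · next y ys hq => exact hC _ _ _ _ hq hs

theorem tagServe_iterate_induction {ρ : List (Fin k × β) → Fin k}
    {C : List (Fin k × β) × (Fin k → List β) → Prop}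
    (hC : ∀ h Q y ys, Q (ρ h) = y :: ys → C (h, Q) →
      C (h ++ [(ρ h, y)], Function.update Q (ρ h) ys))
    {s : List (Fin k × β) × (Fin k → List β)} (hs : C s) (N : ℕ) : C ((tagServe ρ)^[N] s) := by
  induction N with
  | zero => exact hs
  | succ N ih =>
    rw [Function.iterate_succ_apply']
    exact tagServe_induction hC ih

theorem tagServe_iterate_samples (ρ : List (Fin k × β) → Fin k)
    (s : List (Fin k × β) × (Fin k → List β)) (N : ℕ) (a : Fin k) :
    tagSamples ((tagServe ρ)^[N] s).1 a ++ ((tagServe ρ)^[N] s).2 a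
      = tagSamples s.1 a ++ s.2 a := by
  refine tagServe_iterate_induction
    (C := fun s' => tagSamples s'.1 a ++ s'.2 a = tagSamples s.1 a ++ s.2 a)
    (fun h Q y ys hq ih => ?_) rfl N
  rw [← ih, tagSamples_append, tagSamples_singleton]
  by_cases ha : ρ h = a
  · subst ha
    simp [hq]
  · simp [ha, Function.update_of_ne (Ne.symm ha)]

theorem tagDrain_samples (ρ : List (Fin k × β) → Fin k)
    (s : List (Fin k × β) × (Fin k → List β)) (a : Fin k) :
    tagSamples (tagDrain ρ s).1 a ++ (tagDrain ρ s).2 a = tagSamples s.1 a ++ s.2 a :=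
  tagServe_iterate_samples ρ s _ a

theorem tagDrain_follows {ρ : List (Fin k × β) → Fin k}
    {s : List (Fin k × β) × (Fin k → List β)} (hs : Follows ρ s.1) :
    Follows ρ (tagDrain ρ s).1 :=
  tagServe_iterate_induction (C := fun s' => Follows ρ s'.1) (fun _ _ _ _ _ h => h.append _) hs _

theorem prefix_tagDrain (ρ : List (Fin k × β) → Fin k)
    (s : List (Fin k × β) × (Fin k → List β)) : s.1 <+: (tagDrain ρ s).1 :=
  tagServe_iterate_induction (C := fun s' => s.1 <+: s'.1)
    (fun _ _ _ _ _ h => h.trans (List.prefix_append _ _)) (List.prefix_refl _) _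

theorem tagDrain_congr {ρ ρ' : List (Fin k × β) → Fin k} {D : β → Prop}
    (hρ : ∀ h : List (Fin k × β), (∀ a, ∀ y ∈ tagSamples h a, D y) → ρ h = ρ' h)
    {s : List (Fin k × β) × (Fin k → List β)}
    (hs : ∀ a, ∀ y ∈ tagSamples s.1 a ++ s.2 a, D y) : tagDrain ρ s = tagDrain ρ' s := by
  unfold tagDrain
  generalize ∑ a, (s.2 a).length = N
  induction N with
  | zero => rfl
  | succ N ih =>
    have hsel : ρ ((tagServe ρ)^[N] s).1 = ρ' ((tagServe ρ)^[N] s).1 := hρ _ fun a y hy =>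
      hs a y (tagServe_iterate_samples ρ s N a ▸ List.mem_append_left _ hy)
    rw [Function.iterate_succ_apply', Function.iterate_succ_apply', ← ih, tagServe, tagServe, hsel]

/-- Replace the payload `y` of action `a` by the reward `f a y`. -/
def revealHist (f : Fin k → β → ℝ) (h : List (Fin k × β)) : List (Fin k × ℝ) :=
  h.map fun p => (p.1, f p.1 p.2)

/-- The selections of `π`, which reads rewards, on histories with payloads. -/
def tagPolicy (π : List (Fin k × ℝ) → Fin k) (f : Fin k → β → ℝ) (h : List (Fin k × β)) : Fin k :=
  π (revealHist f h)

theorem samples_revealHist (f : Fin k → β → ℝ) (h : List (Fin k × β)) (a : Fin k) :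
    samples (revealHist f h) a = (tagSamples h a).map (f a) := by
  unfold samples tagSamples revealHist
  rw [List.map_filterMap, List.filterMap_map]
  congr 1
  funext p
  by_cases h : p.1 = a <;> simp [h]

theorem tagPolicy_congr (π : List (Fin k × ℝ) → Fin k) {f f' : Fin k → β → ℝ}
    {h : List (Fin k × β)} (hf : ∀ a, ∀ y ∈ tagSamples h a, f a y = f' a y) :
    tagPolicy π f h = tagPolicy π f' h :=
  congrArg π (List.map_congr_left fun p hp => by rw [hf p.1 p.2 (mem_tagSamples.2 hp)])

theorem serve_revealHist (f : Fin k → β → ℝ) (π : List (Fin k × ℝ) → Fin k)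
    (s : List (Fin k × β) × (Fin k → List β)) :
    serve π (revealHist f s.1, fun a => (s.2 a).map (f a))
      = (revealHist f (tagServe (tagPolicy π f) s).1,
        fun a => ((tagServe (tagPolicy π f) s).2 a).map (f a)) := by
  obtain ⟨h, Q⟩ := s
  simp only [serve, tagServe, tagPolicy]
  generalize π (revealHist f h) = b
  rcases hq : Q b with _ | ⟨y, ys⟩
  · simp
  · simp only [List.map_cons, revealHist, List.map_append, List.map_nil, Prod.mk.injEq, true_and]
    funext a
    by_cases ha : a = b
    · subst ha
      simp
    · simp [Function.update_of_ne ha]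

theorem drain_revealHist (f : Fin k → β → ℝ) (π : List (Fin k × ℝ) → Fin k)
    (s : List (Fin k × β) × (Fin k → List β)) :
    drain π (revealHist f s.1, fun a => (s.2 a).map (f a))
      = (revealHist f (tagDrain (tagPolicy π f) s).1,
        fun a => ((tagDrain (tagPolicy π f) s).2 a).map (f a)) := by
  unfold drain tagDrain queued
  simp only [List.length_map]
  generalize ∑ a, (s.2 a).length = N
  induction N with
  | zero => rfl
  | succ N ih =>
    rw [Function.iterate_succ_apply', Function.iterate_succ_apply', ih, serve_revealHist]

theorem tagDrain_queue_eq_nil (f : Fin k → β → ℝ) (π : List (Fin k × ℝ) → Fin k)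
    (s : List (Fin k × β) × (Fin k → List β)) :
    (tagDrain (tagPolicy π f) s).2 (tagPolicy π f (tagDrain (tagPolicy π f) s).1) = [] := by
  have hempty := drain_empty π (revealHist f s.1, fun a => (s.2 a).map (f a))
  rw [drain_revealHist] at hempty
  exact List.map_eq_nil_iff.1 hempty

end Payload

/-! ### The network with rewards tagged by round and agent -/

section TagRun

variable {m k : ℕ}

/-- A round together with an agent: the tag of the reward that the agent obtains in that round. -/
abbrev Slot (m : ℕ) := ℕ × Fin m

/-- `State` with every reward replaced by its slot. All randomness then sits in countably many
values. -/
structure TagState (m k : ℕ) where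
  /-- Number and actions of the completed rounds, most recent round first. -/
  log : List (ℕ × (Fin m → Fin k))
  /-- Actions and slots fed so far to the leader's single-agent algorithm. -/
  hist : List (Fin k × Slot m)
  /-- The leader's queues of slots. -/
  queue : Fin k → List (Slot m)

/-- The reward of action `a` in a slot. -/
def rewardAt (x : ℕ → Fin m → Fin k → ℝ) (a : Fin k) (e : Slot m) : ℝ := x e.1 e.2 a

/-- Replace the slots by the rewards `x`. -/
def TagState.reveal (x : ℕ → Fin m → Fin k → ℝ) (S : TagState m k) : State m k where
  log := S.log.map fun r w => (r.2 w, x r.1 w (r.2 w))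
  hist := revealHist (rewardAt x) S.hist
  queue := fun a => (S.queue a).map (rewardAt x a)

variable (G : SimpleGraph (Fin m)) (v : Fin m)

/-- `inbox` with slots in place of rewards. -/
def tagInbox (log : List (ℕ × (Fin m → Fin k))) : List (Fin k × Slot m) :=
  (List.finRange m).filterMap fun w =>
    if w = v then none else (log[G.dist v w - 1]?).map fun r => (r.2 w, (r.1, w))

/-- History and queues of the leader after it has received the messages of the round. -/
def tagLoad (S : TagState m k) : List (Fin k × Slot m) × (Fin k → List (Slot m)) :=
  (S.hist, fun a => S.queue a ++ tagSamples (tagInbox G v S.log) a)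

/-- The actions of the round. -/
def tagAct (ρ : List (Fin k × Slot m) → Fin k) (u : Fin m → Fin k) (S : TagState m k)
    (w : Fin m) : Fin k :=
  if w = v then ρ (tagDrain ρ (tagLoad G v S)).1
  else match S.log[G.dist v w - 1]? with
    | some r => r.2 v
    | none => u w

/-- `step` with slots in place of rewards, in round `t`. -/
def tagStep (ρ : List (Fin k × Slot m) → Fin k) (t : ℕ) (u : Fin m → Fin k) (S : TagState m k) :
    TagState m k where
  log := (t, tagAct G v ρ u S) :: S.log
  hist := (tagDrain ρ (tagLoad G v S)).1 ++ [(tagAct G v ρ u S v, (t, v))]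
  queue := (tagDrain ρ (tagLoad G v S)).2

variable (π : List (Fin k × ℝ) → Fin k) (x : ℕ → Fin m → Fin k → ℝ) (u : ℕ → Fin m → Fin k)

/-- `run` with slots in place of rewards. -/
def tagRun : ℕ → TagState m k
  | 0 => ⟨[], [], fun _ => []⟩
  | n + 1 => tagStep G v (tagPolicy π (rewardAt x)) n (u n) (tagRun n)

/-- The action of agent `w` in round `t`. -/
def action (t : ℕ) (w : Fin m) : Fin k :=
  tagAct G v (tagPolicy π (rewardAt x)) (u t) (tagRun G v π x u t) w

theorem inbox_reveal (S : TagState m k) :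
    inbox G v (S.reveal x) = revealHist (rewardAt x) (tagInbox G v S.log) := by
  unfold inbox tagInbox State.ago TagState.reveal revealHist rewardAt
  rw [List.map_filterMap]
  congr 1
  funext w
  by_cases h : w = v <;> simp [h, Function.comp_def]

theorem drain_reveal (S : TagState m k) :
    drain π ((S.reveal x).hist,
        fun a => (S.reveal x).queue a ++ samples (inbox G v (S.reveal x)) a)
      = (revealHist (rewardAt x) (tagDrain (tagPolicy π (rewardAt x)) (tagLoad G v S)).1,
        fun a => ((tagDrain (tagPolicy π (rewardAt x)) (tagLoad G v S)).2 a).map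
          (rewardAt x a)) := by
  rw [← drain_revealHist]
  simp only [inbox_reveal, samples_revealHist]
  simp only [TagState.reveal, tagLoad, List.map_append]

theorem step_eq {x : Fin m → Fin k → ℝ} {u : Fin m → Fin k} {S : State m k}
    {L : List (Fin k × ℝ) × (Fin k → List ℝ)} {act : Fin m → Fin k}
    (hL : drain π (S.hist, fun a => S.queue a ++ samples (inbox G v S) a) = L)
    (hact : ∀ w, (if w = v then π L.1
      else match S.ago (G.dist v w) with
        | some r => (r v).1
        | none => u w) = act w) :
    step G v π x u S
      = ⟨(fun w => (act w, x w (act w))) :: S.log, L.1 ++ [(act v, x v (act v))], L.2⟩ := by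
  subst hL
  obtain rfl := funext hact
  rfl

theorem step_reveal (t : ℕ) (u : Fin m → Fin k) (S : TagState m k) :
    step G v π (x t) u (S.reveal x)
      = (tagStep G v (tagPolicy π (rewardAt x)) t u S).reveal x := by
  have hact (w : Fin m) : (if w = v then
        π (revealHist (rewardAt x) (tagDrain (tagPolicy π (rewardAt x)) (tagLoad G v S)).1)
      else match (S.reveal x).ago (G.dist v w) with
        | some r => (r v).1
        | none => u w) = tagAct G v (tagPolicy π (rewardAt x)) u S w := by
    simp only [tagAct, State.ago, TagState.reveal, List.getElem?_map]
    rcases S.log[G.dist v w - 1]? <;> rfl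
  rw [step_eq G v π (drain_reveal G v π x S) hact]
  simp only [TagState.reveal, tagStep, revealHist, List.map_cons, List.map_append, List.map_nil,
    rewardAt]

theorem run_eq_reveal (n : ℕ) : run G v π x u n = (tagRun G v π x u n).reveal x := by
  induction n with
  | zero => rfl
  | succ n ih => rw [run, ih, step_reveal, tagRun]

end TagRun

/-! ### Order of arrival -/

section Arrival

variable {m : ℕ} {G : SimpleGraph (Fin m)} {v : Fin m}

variable (G v) in
/-- The slots whose rewards reach the leader by message in round `t`. -/
def incoming (t : ℕ) : List (Slot m) :=
  (List.finRange m).filterMap fun w =>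
    if w = v then none else if G.dist v w ≤ t then some (t - G.dist v w, w) else none

variable (G v) in
/-- The slots whose rewards the leader has after `n` rounds, in the order of arrival. Its own reward
comes last in each round. -/
def slots : ℕ → List (Slot m)
  | 0 => []
  | n + 1 => slots n ++ (incoming G v n ++ [(n, v)])

variable (G v) in
/-- The slots whose rewards the leader has when it acts in round `t`. -/
def known (t : ℕ) : List (Slot m) := slots G v t ++ incoming G v t

theorem mem_incoming {t : ℕ} {e : Slot m} :
    e ∈ incoming G v t ↔ e.2 ≠ v ∧ e.1 + G.dist v e.2 = t := by
  obtain ⟨τ, w⟩ := e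
  simp only [incoming, List.mem_filterMap, List.mem_finRange, true_and]
  constructor
  · rintro ⟨w', hw'⟩
    split_ifs at hw' with hne hle
    obtain ⟨rfl, rfl⟩ : t - G.dist v w' = τ ∧ w' = w := by simpa using hw'
    exact ⟨hne, Nat.sub_add_cancel hle⟩
  · rintro ⟨hne, rfl⟩
    exact ⟨w, by simp [hne]⟩

theorem mem_slots {n : ℕ} {e : Slot m} : e ∈ slots G v n ↔ e.1 + G.dist v e.2 < n := by
  induction n with
  | zero => simp [slots]
  | succ n ih =>
    rw [slots, List.mem_append, List.mem_append, ih, mem_incoming, List.mem_singleton]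
    obtain ⟨τ, w⟩ := e
    by_cases hw : w = v
    · subst hw
      simp only [SimpleGraph.dist_self, Prod.mk.injEq, ne_eq, not_true, false_and, false_or,
        and_true]
      omega
    · simp only [ne_eq, hw, not_false_eq_true, true_and, Prod.mk.injEq, and_false, or_false]
      omega

theorem mem_known {t : ℕ} {e : Slot m} :
    e ∈ known G v t ↔ e.1 + G.dist v e.2 < t ∨ e.2 ≠ v ∧ e.1 + G.dist v e.2 = t := by
  rw [known, List.mem_append, mem_slots, mem_incoming]

theorem nodup_incoming (t : ℕ) : (incoming G v t).Nodup := by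
  refine List.Nodup.filterMap (fun w w' e he he' => ?_) (List.nodup_finRange m)
  simp only [Option.mem_def] at he he'
  split_ifs at he he'
  exact congrArg Prod.snd (Option.some.inj (he.trans he'.symm))

theorem nodup_slots (n : ℕ) : (slots G v n).Nodup := by
  induction n with
  | zero => exact List.nodup_nil
  | succ n ih =>
    rw [slots, List.nodup_append', List.nodup_append']
    refine ⟨ih, ⟨nodup_incoming n, List.nodup_singleton _, ?_⟩, fun e hold hnew => ?_⟩
    · exact List.disjoint_singleton.2 fun h => (mem_incoming.1 h).1 rfl
    · rw [mem_slots] at hold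
      rcases List.mem_append.1 hnew with hnew | hnew
      · exact hold.ne (mem_incoming.1 hnew).2
      · rw [List.mem_singleton.1 hnew] at hold
        simp at hold

theorem length_filter_slots (p : Slot m → Prop) [DecidablePred p] (n : ℕ) :
    ((slots G v n).filter p).length
      = ∑ w, ((Finset.range (n - G.dist v w)).filter fun τ => p (τ, w)).card := by
  rw [← List.toFinset_card_of_nodup ((nodup_slots n).filter _),
    Finset.card_eq_sum_card_fiberwise (f := Prod.snd) (t := Finset.univ) fun _ _ =>
      Finset.mem_univ _]
  refine Finset.sum_congr rfl fun w _ => ?_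
  refine Finset.card_nbij' Prod.fst (fun τ => (τ, w)) ?_ ?_ ?_ ?_
  · rintro ⟨τ, w'⟩ he
    obtain ⟨⟨hslot, hp⟩, rfl⟩ : (τ + G.dist v w' < n ∧ p (τ, w')) ∧ w' = w := by
      simpa [mem_slots] using he
    simpa using ⟨Nat.lt_sub_of_add_lt hslot, hp⟩
  · intro τ hτ
    obtain ⟨hlt, hp⟩ : τ < n - G.dist v w ∧ p (τ, w) := by simpa using hτ
    simpa [mem_slots] using ⟨Nat.add_lt_of_lt_sub hlt, hp⟩
  · rintro ⟨τ, w'⟩ he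
    simp only [Finset.coe_filter, Set.mem_ofPred_eq] at he
    rw [he.2]
  · exact fun τ _ => rfl

theorem length_slots_le (n : ℕ) : (slots G v n).length ≤ m * n := by
  have h := length_filter_slots (G := G) (v := v) (fun _ => True) n
  simp only [decide_true, List.filter_true, Finset.filter_true, Finset.card_range] at h
  rw [h]
  calc ∑ w, (n - G.dist v w) ≤ ∑ _w : Fin m, n := Finset.sum_le_sum fun w _ => Nat.sub_le n _
    _ = m * n := by simp

theorem dist_pos_of_ne (hG : G.Connected) {w : Fin m} (hw : w ≠ v) : 0 < G.dist v w :=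
  hG.pos_dist_of_ne hw.symm

theorem notMem_known_self (hG : G.Connected) (e : Slot m) : e ∉ known G v e.1 := by
  rw [mem_known]
  rintro (h | ⟨hne, h⟩)
  · omega
  · have := dist_pos_of_ne hG hne
    omega

theorem pairwise_slots (hG : G.Connected) (n : ℕ) :
    (slots G v n).Pairwise fun e e' => e' ∉ known G v e.1 := by
  induction n with
  | zero => exact List.Pairwise.nil
  | succ n ih =>
    have hlt {e : Slot m} (he : e ∈ incoming G v n) : e.1 < n := by
      obtain ⟨hne, hround⟩ := mem_incoming.1 he
      have := dist_pos_of_ne hG hne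
      omega
    have hlate {e e' : Slot m} (he : e.1 < n) (he' : n ≤ e'.1 + G.dist v e'.2) :
        e' ∉ known G v e.1 := by
      rw [mem_known]
      omega
    have hself : n ≤ n + G.dist v v := Nat.le_add_right _ _
    rw [slots, List.pairwise_append, List.pairwise_append]
    refine ⟨ih, ⟨List.pairwise_of_forall_mem_list fun e he e' he' =>
      hlate (hlt he) (mem_incoming.1 he').2.ge, List.pairwise_singleton _ _, ?_⟩, ?_⟩
    · intro e he e' he'
      rw [List.mem_singleton.1 he']
      exact hlate (hlt he) hself
    · intro e he e' he'
      have hold : e.1 < n := (Nat.le_add_right _ _).trans_lt (mem_slots.1 he)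
      rcases List.mem_append.1 he' with he' | he'
      · exact hlate hold (mem_incoming.1 he').2.ge
      · rw [List.mem_singleton.1 he']
        exact hlate hold hself

theorem mem_of_mem_known_of_slots_eq (hG : G.Connected) {n : ℕ} {l₁ l₂ : List (Slot m)}
    {e e' : Slot m} (hl : slots G v n = l₁ ++ e :: l₂) (he' : e' ∈ known G v e.1) : e' ∈ l₁ := by
  have he : e.1 + G.dist v e.2 < n := mem_slots.1 (hl ▸ by simp)
  have hmem : e' ∈ l₁ ++ e :: l₂ := by
    rw [← hl, mem_slots]
    rcases mem_known.1 he' with h | ⟨-, h⟩ <;> omega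
  have hpair := pairwise_slots (v := v) hG n
  rw [hl, List.pairwise_append, List.pairwise_cons] at hpair
  rcases List.mem_append.1 hmem with hmem | hmem
  · exact hmem
  · rcases List.mem_cons.1 hmem with rfl | hmem
    · exact absurd he' (notMem_known_self hG e')
    · exact absurd he' (hpair.2.1.1 e' hmem)

end Arrival

/-! ### What the leader has seen -/

section Run

variable {m k : ℕ} {G : SimpleGraph (Fin m)} {v : Fin m}

section

variable (G v) (π : List (Fin k × ℝ) → Fin k) (x : ℕ → Fin m → Fin k → ℝ)
  (u : ℕ → Fin m → Fin k)

theorem action_leader (n : ℕ) :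
    action G v π x u n v = tagPolicy π (rewardAt x)
      (tagDrain (tagPolicy π (rewardAt x)) (tagLoad G v (tagRun G v π x u n))).1 := by
  rw [action, tagAct, if_pos rfl]

theorem tagRun_succ_hist (n : ℕ) :
    (tagRun G v π x u (n + 1)).hist
      = (tagDrain (tagPolicy π (rewardAt x)) (tagLoad G v (tagRun G v π x u n))).1
        ++ [(action G v π x u n v, (n, v))] :=
  rfl

theorem tagRun_succ_queue (n : ℕ) :
    (tagRun G v π x u (n + 1)).queue
      = (tagDrain (tagPolicy π (rewardAt x)) (tagLoad G v (tagRun G v π x u n))).2 :=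
  rfl

theorem tagRun_log (n : ℕ) :
    (tagRun G v π x u n).log = (List.range n).reverse.map fun t => (t, action G v π x u t) := by
  induction n with
  | zero => rfl
  | succ n ih =>
    rw [tagRun, tagStep, ih, List.range_succ, List.reverse_append, List.map_append]
    rfl

theorem tagRun_log_getElem? (n : ℕ) {d : ℕ} (hd : 0 < d) :
    (tagRun G v π x u n).log[d - 1]?
      = if d ≤ n then some (n - d, action G v π x u (n - d)) else none := by
  rw [tagRun_log, List.getElem?_map]
  split_ifs with hdn
  · rw [List.getElem?_reverse (by rw [List.length_range]; omega), List.length_range,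
      List.getElem?_range (by omega), Option.map_some, show n - 1 - (d - 1) = n - d by omega]
  · rw [List.getElem?_eq_none (by rw [List.length_reverse, List.length_range]; omega),
      Option.map_none]

theorem tagRun_queue_eq_nil (n : ℕ) :
    (tagRun G v π x u (n + 1)).queue (action G v π x u n v) = [] := by
  rw [tagRun_succ_queue, action_leader]
  exact tagDrain_queue_eq_nil _ π _

theorem tagRun_follows (n : ℕ) :
    Follows (tagPolicy π (rewardAt x)) (tagRun G v π x u n).hist := by
  induction n with
  | zero => exact fun l p hl => absurd (List.prefix_nil.1 hl) (by simp)
  | succ n ih =>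
    rw [tagRun_succ_hist, action_leader]
    exact (tagDrain_follows (s := tagLoad G v (tagRun G v π x u n)) ih).append (n, v)

theorem tagRun_hist_prefix {i j : ℕ} (h : i ≤ j) :
    (tagRun G v π x u i).hist <+: (tagRun G v π x u j).hist := by
  induction j, h using Nat.le_induction with
  | base => exact List.prefix_refl _
  | succ n _ ih =>
    exact ih.trans ((prefix_tagDrain _ (tagLoad G v (tagRun G v π x u n))).trans
      (List.prefix_append _ _))

theorem plays_eq_card (n : ℕ) (w : Fin m) (a : Fin k) :
    plays G v π x u n w a = ((Finset.range n).filter fun t => action G v π x u t w = a).card := by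
  rw [plays, run_eq_reveal, TagState.reveal, tagRun_log]
  simp only [List.map_map, List.countP_map, List.countP_reverse]
  induction n with
  | zero => rfl
  | succ n ih =>
    rw [List.range_succ, List.countP_append, ih, Finset.range_add_one, Finset.filter_insert]
    by_cases h : action G v π x u n w = a <;> simp [h]

end

variable (π : List (Fin k × ℝ) → Fin k) (x : ℕ → Fin m → Fin k → ℝ) (u : ℕ → Fin m → Fin k)

theorem action_follower (hG : G.Connected) {w : Fin m} (hw : w ≠ v) {t : ℕ}
    (ht : G.dist v w ≤ t) :
    action G v π x u t w = action G v π x u (t - G.dist v w) v := by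
  rw [action, tagAct, if_neg hw, tagRun_log_getElem? G v π x u t (dist_pos_of_ne hG hw), if_pos ht]

theorem tagInbox_tagRun (hG : G.Connected) (n : ℕ) :
    tagInbox G v (tagRun G v π x u n).log
      = (incoming G v n).map fun e => (action G v π x u e.1 e.2, e) := by
  rw [tagInbox, incoming, List.map_filterMap]
  congr 1
  funext w
  by_cases hw : w = v
  · simp [hw]
  · rw [if_neg hw, if_neg hw, tagRun_log_getElem? G v π x u n (dist_pos_of_ne hG hw)]
    split_ifs <;> rfl

theorem tagLoad_tagRun_queue (hG : G.Connected) (n : ℕ) (a : Fin k) :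
    (tagLoad G v (tagRun G v π x u n)).2 a
      = (tagRun G v π x u n).queue a
        ++ (incoming G v n).filter fun e => action G v π x u e.1 e.2 = a := by
  rw [tagLoad, tagInbox_tagRun π x u hG,
    ← tagSamples_map_graph (fun e : Slot m => action G v π x u e.1 e.2)]

theorem samples_append_queue (hG : G.Connected) (n : ℕ) (a : Fin k) :
    tagSamples (tagRun G v π x u n).hist a ++ (tagRun G v π x u n).queue a
      = (slots G v n).filter fun e => action G v π x u e.1 e.2 = a := by
  induction n with
  | zero => rfl
  | succ n ih =>
    have hdrain := tagDrain_samples (tagPolicy π (rewardAt x))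
      (tagLoad G v (tagRun G v π x u n)) a
    rw [tagLoad_tagRun_queue π x u hG, ← List.append_assoc, tagLoad, ih] at hdrain
    rw [slots, List.filter_append, List.filter_append, ← List.append_assoc, ← hdrain]
    by_cases ha : action G v π x u n v = a
    · have hnil := tagRun_queue_eq_nil G v π x u n
      rw [ha, tagRun_succ_queue] at hnil
      rw [tagRun_succ_hist, tagRun_succ_queue, tagSamples_append, tagSamples_singleton, if_pos ha,
        ← tagLoad, hnil]
      simp [ha]
    · rw [tagRun_succ_hist, tagRun_succ_queue, tagSamples_append, tagSamples_singleton, if_neg ha,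
        ← tagLoad]
      simp [ha]

theorem samples_append_loaded (hG : G.Connected) (n : ℕ) (a : Fin k) :
    tagSamples (tagLoad G v (tagRun G v π x u n)).1 a ++ (tagLoad G v (tagRun G v π x u n)).2 a
      = (known G v n).filter fun e => action G v π x u e.1 e.2 = a := by
  rw [tagLoad_tagRun_queue π x u hG, ← List.append_assoc, tagLoad, samples_append_queue π x u hG,
    known, List.filter_append]

theorem length_hist_le (hG : G.Connected) (n : ℕ) : (tagRun G v π x u n).hist.length ≤ m * n := by
  rw [← sum_length_tagSamples]
  calc ∑ a, (tagSamples (tagRun G v π x u n).hist a).length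
      ≤ ∑ a, ((slots G v n).filter fun e => action G v π x u e.1 e.2 = a).length := by
        refine Finset.sum_le_sum fun a _ => ?_
        rw [← samples_append_queue π x u hG, List.length_append]
        exact Nat.le_add_right _ _
    _ = (slots G v n).length := by
        simp only [← tagSamples_map_graph (fun e : Slot m => action G v π x u e.1 e.2),
          sum_length_tagSamples, List.length_map]
    _ ≤ m * n := length_slots_le n

variable (G v) in
theorem exists_queue_eq_nil (n : ℕ) (a : Fin k) :
    ∃ T ≤ n, (tagRun G v π x u T).queue a = [] ∧
      ∀ t, T ≤ t → t < n → action G v π x u t v ≠ a := by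
  induction n with
  | zero => exact ⟨0, le_rfl, rfl, fun t _ h => absurd h (Nat.not_lt_zero t)⟩
  | succ n ih =>
    by_cases ha : action G v π x u n v = a
    · exact ⟨n + 1, le_rfl, ha ▸ tagRun_queue_eq_nil G v π x u n, fun t h1 h2 => by omega⟩
    · obtain ⟨T, hTn, hnil, hne⟩ := ih
      refine ⟨T, hTn.trans n.le_succ, hnil, fun t hTt htn => ?_⟩
      rcases Nat.lt_succ_iff_lt_or_eq.1 htn with h | rfl
      · exact hne t hTt h
      · exact ha

theorem plays_le_card_add (hG : G.Connected) {n T : ℕ} {a : Fin k}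
    (hne : ∀ t, T ≤ t → t < n → action G v π x u t v ≠ a) (w : Fin m) :
    plays G v π x u n w a
      ≤ ((Finset.range (T - G.dist v w)).filter fun t => action G v π x u t w = a).card
        + 2 * G.dist v w := by
  have hsub : ((Finset.range n).filter fun t => action G v π x u t w = a)
      ⊆ ((Finset.range (T - G.dist v w)).filter fun t => action G v π x u t w = a)
        ∪ Finset.Ico (T - G.dist v w) (T + G.dist v w) := by
    intro t ht
    obtain ⟨htn, hta⟩ : t < n ∧ action G v π x u t w = a := by simpa using ht
    simp only [Finset.mem_union, Finset.mem_filter, Finset.mem_range, Finset.mem_Ico]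
    by_cases hlate : T + G.dist v w ≤ t
    · refine absurd hta ?_
      by_cases hw : w = v
      · subst hw
        exact hne t (by omega) htn
      · rw [action_follower π x u hG hw (by omega)]
        exact hne _ (by omega) (by omega)
    · by_cases hearly : t < T - G.dist v w
      · exact Or.inl ⟨hearly, hta⟩
      · exact Or.inr ⟨by omega, by omega⟩
  rw [plays_eq_card]
  refine (Finset.card_le_card hsub).trans ((Finset.card_union_le _ _).trans ?_)
  rw [Nat.card_Ico]
  omega

/-- Consider a time at which the queue of `a` was empty and after which the leader avoids `a`: all
that was played before it has been fed to the algorithm, except what was still in transit. -/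
theorem sum_plays_le (hG : G.Connected) (n : ℕ) (a : Fin k) :
    ∑ w, plays G v π x u n w a
      ≤ (tagSamples (tagRun G v π x u n).hist a).length + 2 * ∑ w, G.dist v w := by
  obtain ⟨T, hTn, hnil, hne⟩ := exists_queue_eq_nil G v π x u n a
  have hfed : ∑ w, ((Finset.range (T - G.dist v w)).filter
      fun t => action G v π x u t w = a).card
      ≤ (tagSamples (tagRun G v π x u n).hist a).length := by
    rw [← length_filter_slots fun e => action G v π x u e.1 e.2 = a,
      ← samples_append_queue π x u hG, hnil, List.append_nil]
    exact ((tagRun_hist_prefix G v π x u hTn).sublist.filterMap _).length_le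
  calc ∑ w, plays G v π x u n w a
    _ ≤ ∑ w, (((Finset.range (T - G.dist v w)).filter
          fun t => action G v π x u t w = a).card + 2 * G.dist v w) :=
        Finset.sum_le_sum fun w _ => plays_le_card_add π x u hG hne w
    _ ≤ (tagSamples (tagRun G v π x u n).hist a).length + 2 * ∑ w, G.dist v w := by
        rw [Finset.sum_add_distrib, ← Finset.mul_sum]
        exact Nat.add_le_add_right hfed _

end Run

/-! ### Which rewards the actions depend on -/

section Locality

variable {m k : ℕ} {G : SimpleGraph (Fin m)} {v : Fin m} (π : List (Fin k × ℝ) → Fin k)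
  {x x' : ℕ → Fin m → Fin k → ℝ} (u : ℕ → Fin m → Fin k)

theorem tagDrain_tagRun_congr (hG : G.Connected) {n : ℕ}
    (hx : ∀ e ∈ known G v n, x e.1 e.2 = x' e.1 e.2) :
    let s := tagLoad G v (tagRun G v π x u n)
    let D := tagDrain (tagPolicy π (rewardAt x)) s
    D = tagDrain (tagPolicy π (rewardAt x')) s ∧
      tagPolicy π (rewardAt x) D.1 = tagPolicy π (rewardAt x') D.1 := by
  intro s D
  have hs : ∀ a, ∀ e ∈ tagSamples s.1 a ++ s.2 a, e ∈ known G v n := fun a e he => by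
    rw [samples_append_loaded π x u hG] at he
    exact List.mem_of_mem_filter he
  have hρ (h : List (Fin k × Slot m)) (hh : ∀ a, ∀ e ∈ tagSamples h a, e ∈ known G v n) :
      tagPolicy π (rewardAt x) h = tagPolicy π (rewardAt x') h :=
    tagPolicy_congr π fun a e he => congrFun (hx e (hh a e he)) a
  refine ⟨tagDrain_congr hρ hs, hρ _ fun a e he => hs a e ?_⟩
  rw [← tagDrain_samples (tagPolicy π (rewardAt x)) s a]
  exact List.mem_append_left _ he

theorem action_and_tagRun_succ_congr (hG : G.Connected) {n : ℕ}
    (hrun : tagRun G v π x u n = tagRun G v π x' u n)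
    (hx : ∀ e ∈ known G v n, x e.1 e.2 = x' e.1 e.2) :
    action G v π x u n = action G v π x' u n ∧
      tagRun G v π x u (n + 1) = tagRun G v π x' u (n + 1) := by
  obtain ⟨hdrain, hsel⟩ := tagDrain_tagRun_congr π u hG hx
  have hact : tagAct G v (tagPolicy π (rewardAt x)) (u n) (tagRun G v π x u n)
      = tagAct G v (tagPolicy π (rewardAt x')) (u n) (tagRun G v π x' u n) := by
    funext w
    rw [← hrun, tagAct, tagAct, ← hdrain, hsel]
  refine ⟨hact, ?_⟩
  rw [tagRun, tagRun, tagStep, tagStep, hact, ← hrun, hdrain]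

theorem tagRun_congr (hG : G.Connected) {n : ℕ}
    (hx : ∀ e ∈ slots G v n, x e.1 e.2 = x' e.1 e.2) :
    tagRun G v π x u n = tagRun G v π x' u n := by
  induction n with
  | zero => rfl
  | succ n ih =>
    rw [slots, ← List.append_assoc, ← known] at hx
    refine (action_and_tagRun_succ_congr π u hG (ih fun e he => ?_) fun e he => ?_).2
    · exact hx e (List.mem_append_left _ (List.mem_append_left _ he))
    · exact hx e (List.mem_append_left _ he)

theorem action_congr (hG : G.Connected) {t : ℕ}
    (hx : ∀ e ∈ known G v t, x e.1 e.2 = x' e.1 e.2) :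
    action G v π x u t = action G v π x' u t :=
  (action_and_tagRun_succ_congr π u hG
    (tagRun_congr π u hG fun e he => hx e (List.mem_append_left _ he)) hx).1

theorem action_congr_of_slots_eq (hG : G.Connected) {n : ℕ} {l₁ l₂ : List (Slot m)} {e : Slot m}
    (hl : slots G v n = l₁ ++ e :: l₂) (hx : ∀ e' ∈ l₁, x e'.1 e'.2 = x' e'.1 e'.2) :
    action G v π x u e.1 e.2 = action G v π x' u e.1 e.2 :=
  congrFun (action_congr π u hG fun e' he' =>
    hx e' (mem_of_mem_known_of_slots_eq hG hl he')) e.2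

end Locality

/-! ### Measurability of the run -/

section Measurability

theorem measurable_bind {α β γ : Type*} [MeasurableSpace α] [MeasurableSpace β] [Countable β]
    [MeasurableSingletonClass β] [MeasurableSpace γ] {f : α → β} {g : α → β → γ}
    (hf : Measurable f) (hg : ∀ b, Measurable fun p => g p b) : Measurable fun p => g p (f p) :=
  (measurable_from_prod_countable_left (f := fun q : α × β => g q.1 q.2) hg).comp
    (measurable_id.prodMk hf)

variable {m k : ℕ}

instance : Countable (TagState m k) :=
  Function.Injective.countable (f := fun S : TagState m k => (S.log, S.hist, S.queue))
    fun S S' h => by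
      cases S
      cases S'
      simpa using h

/-- The rewards of all slots, for each possible action, and the exploratory actions. -/
abbrev Noise (m k : ℕ) : Type := (ℕ → Fin m → Fin k → ℝ) × (ℕ → Fin m → Fin k)

local instance : MeasurableSpace (TagState m k) := ⊤
local instance : MeasurableSpace (List (Slot m)) := ⊤
local instance : MeasurableSpace (List (Fin k × Slot m)) := ⊤

variable {G : SimpleGraph (Fin m)} {v : Fin m} {π : List (Fin k × ℝ) → Fin k}

theorem measurable_tagPolicy (hπ : MeasurablePolicy π) (h : List (Fin k × Slot m)) :
    Measurable fun p : Noise m k => tagPolicy π (rewardAt p.1) h := by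
  have hofFn (p : Noise m k) : tagPolicy π (rewardAt p.1) h
      = π (List.ofFn fun i : Fin h.length => (h[i].1, rewardAt p.1 h[i].1 h[i].2)) :=
    congrArg π (List.ofFn_getElem_eq_map h fun q => (q.1, rewardAt p.1 q.1 q.2)).symm
  simp_rw [hofFn, rewardAt]
  exact (hπ h.length).comp (by fun_prop)

theorem measurable_tagDrain (hπ : MeasurablePolicy π)
    (s : List (Fin k × Slot m) × (Fin k → List (Slot m))) :
    Measurable fun p : Noise m k => tagDrain (tagPolicy π (rewardAt p.1)) s := by
  unfold tagDrain
  generalize ∑ a, (s.2 a).length = N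
  induction N with
  | zero => exact measurable_const
  | succ N ih =>
    simp_rw [Function.iterate_succ_apply']
    refine measurable_bind (g := fun p s' => tagServe (tagPolicy π (rewardAt p.1)) s') ih
      fun s' => ?_
    exact (Measurable.of_discrete (f := fun b => tagServe (fun _ => b) s')).comp
      (measurable_tagPolicy hπ s'.1)

theorem measurable_tagAct (hπ : MeasurablePolicy π) (t : ℕ) (S : TagState m k) :
    Measurable fun p : Noise m k => tagAct G v (tagPolicy π (rewardAt p.1)) (p.2 t) S := by
  refine measurable_pi_lambda _ fun w => ?_
  unfold tagAct
  split_ifs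
  · exact measurable_bind (g := fun (p : Noise m k) L => tagPolicy π (rewardAt p.1) L)
      (measurable_tagDrain hπ _).fst (measurable_tagPolicy hπ)
  · split <;> fun_prop

theorem measurable_tagRun (hπ : MeasurablePolicy π) (n : ℕ) :
    Measurable fun p : Noise m k => tagRun G v π p.1 p.2 n := by
  induction n with
  | zero => exact measurable_const
  | succ n ih =>
    refine measurable_bind
      (g := fun p S => tagStep G v (tagPolicy π (rewardAt p.1)) n (p.2 n) S) ih fun S => ?_
    let assemble (q : (Fin m → Fin k) × List (Fin k × Slot m) × (Fin k → List (Slot m))) :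
        TagState m k := ⟨(n, q.1) :: S.log, q.2.1 ++ [(q.1 v, (n, v))], q.2.2⟩
    exact (Measurable.of_discrete (f := assemble)).comp
      ((measurable_tagAct hπ n S).prodMk (measurable_tagDrain hπ (tagLoad G v S)))

theorem measurable_action (hπ : MeasurablePolicy π) (t : ℕ) (w : Fin m) :
    Measurable fun p : Noise m k => action G v π p.1 p.2 t w :=
  measurable_bind
    (g := fun (p : Noise m k) S => tagAct G v (tagPolicy π (rewardAt p.1)) (p.2 t) S w)
    (measurable_tagRun hπ t) fun S => measurable_pi_iff.1 (measurable_tagAct hπ t S) w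

/-- The rewards obtained in those slots of `l` at which action `a` is played. -/
def arrivals (G : SimpleGraph (Fin m)) (v : Fin m) (π : List (Fin k × ℝ) → Fin k) (a : Fin k)
    (l : List (Slot m)) (p : Noise m k) : List ℝ :=
  (l.filter fun e => action G v π p.1 p.2 e.1 e.2 = a).map (rewardAt p.1 a)

theorem arrivals_append_singleton (a : Fin k) (l : List (Slot m)) (e : Slot m) (p : Noise m k) :
    arrivals G v π a (l ++ [e]) p = arrivals G v π a l p ++
      if action G v π p.1 p.2 e.1 e.2 = a then [rewardAt p.1 a e] else [] := by
  unfold arrivals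
  rw [List.filter_append, List.map_append]
  by_cases h : action G v π p.1 p.2 e.1 e.2 = a <;> simp [h]

theorem measurable_filter_action (hπ : MeasurablePolicy π) (a : Fin k) (l : List (Slot m)) :
    Measurable fun p : Noise m k => l.filter fun e => action G v π p.1 p.2 e.1 e.2 = a := by
  induction l with
  | nil => exact measurable_const
  | cons e l ih =>
    let extend (q : Fin k × List (Slot m)) : List (Slot m) := if q.1 = a then e :: q.2 else q.2
    convert (Measurable.of_discrete (f := extend)).comp
      ((measurable_action (G := G) (v := v) hπ e.1 e.2).prodMk ih) using 2 with p
    simp [extend, List.filter_cons]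

theorem measurable_comp_arrivals {γ : Type*} [MeasurableSpace γ] (hπ : MeasurablePolicy π)
    (a : Fin k) (l : List (Slot m)) {g : List ℝ → γ}
    (hg : ∀ j, Measurable fun y : Fin j → ℝ => g (List.ofFn y)) :
    Measurable fun p : Noise m k => g (arrivals G v π a l p) := by
  refine measurable_bind (g := fun p l' => g (l'.map (rewardAt p.1 a)))
    (measurable_filter_action hπ a l) fun l' => ?_
  simp_rw [← List.ofFn_getElem_eq_map, rewardAt]
  exact (hg l'.length).comp (by fun_prop)

end Measurability

/-! ### Independence of the arriving rewards -/

section Independence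

variable {Ω : Type*} [MeasurableSpace Ω] {P : Measure Ω}

theorem indepFun_pi_of_notMem {ι : Type*} {β : ι → Type*} [∀ i, MeasurableSpace (β i)]
    {f : ∀ i, Ω → β i} (hf : ∀ i, Measurable (f i)) (hindep : iIndepFun f P) {i : ι} {T : Set ι}
    (hi : i ∉ T) : IndepFun (f i) (fun ω (j : T) => f j ω) P := by
  have hsup := indep_iSup_of_disjoint (fun i => (hf i).comap_le) hindep
    (Set.disjoint_singleton_left.2 hi)
  rw [iSup_singleton] at hsup
  refine indep_of_indep_of_le_right hsup ?_
  rw [MeasurableSpace.pi, MeasurableSpace.comap_iSup]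
  refine iSup_le fun j => ?_
  rw [MeasurableSpace.comap_comp]
  exact le_iSup₂_of_le j.1 j.2 le_rfl

theorem indepFun_prodMk_of_indepFun {α β γ : Type*} [MeasurableSpace α] [MeasurableSpace β]
    [MeasurableSpace γ] [IsFiniteMeasure P] {A : Ω → α} {B : Ω → β} {C : Ω → γ}
    (hA : Measurable A) (hB : Measurable B) (hC : Measurable C) (hAB : IndepFun A B P)
    (hABC : IndepFun (fun ω => (A ω, B ω)) C P) : IndepFun A (fun ω => (B ω, C ω)) P := by
  have hBC : IndepFun B C P := hABC.comp measurable_snd measurable_id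
  rw [indepFun_iff_map_prod_eq_prod_map_map (by fun_prop) (by fun_prop)] at hAB hBC hABC ⊢
  rw [hBC, ← (measurePreserving_prodAssoc (P.map A) (P.map B) (P.map C)).map_eq, ← hAB, ← hABC,
    Measure.map_map (by fun_prop) (by fun_prop)]
  rfl

theorem lintegral_mul_le_of_indepFun {β γ : Type*} [MeasurableSpace β] [MeasurableSpace γ]
    [IsFiniteMeasure P] {Y : Ω → β} {Z : Ω → γ} (hY : Measurable Y) (hZ : Measurable Z)
    (hindep : IndepFun Y Z P) {g : β → ENNReal} (hg : Measurable g) {f : β → γ → ENNReal}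
    (hf : Measurable (Function.uncurry f)) (hf1 : ∀ y, ∫⁻ z, f y z ∂P.map Z ≤ 1) :
    ∫⁻ ω, g (Y ω) * f (Y ω) (Z ω) ∂P ≤ ∫⁻ ω, g (Y ω) ∂P := by
  have hgf : Measurable fun q : β × γ => g q.1 * f q.1 q.2 := (hg.comp measurable_fst).mul hf
  have hlaw := (indepFun_iff_map_prod_eq_prod_map_map hY.aemeasurable hZ.aemeasurable).1 hindep
  calc ∫⁻ ω, g (Y ω) * f (Y ω) (Z ω) ∂P
    _ = ∫⁻ q, g q.1 * f q.1 q.2 ∂(P.map Y).prod (P.map Z) := by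
        rw [← hlaw, lintegral_map hgf (hY.prodMk hZ)]
    _ = ∫⁻ y, g y * ∫⁻ z, f y z ∂P.map Z ∂P.map Y := by
        rw [lintegral_prod _ hgf.aemeasurable]
        exact lintegral_congr fun y =>
          lintegral_const_mul (g y) (f := f y) (hf.comp measurable_prodMk_left)
    _ ≤ ∫⁻ y, g y ∂P.map Y := lintegral_mono fun y => mul_le_of_le_one_right' (hf1 y)
    _ = ∫⁻ ω, g (Y ω) ∂P := lintegral_map hg hY

end Independence

section RewardModel

variable {m k : ℕ} {Ω : Type*} [MeasurableSpace Ω] {P : Measure Ω} {ν : Fin k → Measure ℝ}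
  {X : ℕ → Fin m → Fin k → Ω → ℝ} {U : ℕ → Fin m → Ω → Fin k}

/-- A weakening of `IsEnvironment`: every reward has the law of its action and is independent of
the rewards of the other slots together with all exploratory actions. The rewards of different
actions in one slot may depend on each other, and the exploratory actions may have any joint law. -/
structure IsRewardModel (P : Measure Ω) (ν : Fin k → Measure ℝ) (X : ℕ → Fin m → Fin k → Ω → ℝ)
    (U : ℕ → Fin m → Ω → Fin k) : Prop where
  measurable_reward : ∀ t w a, Measurable (X t w a)
  map_reward : ∀ t w a, P.map (X t w a) = ν a
  measurable_explore : ∀ t w, Measurable (U t w)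
  indep : ∀ t w a, IndepFun
    (fun ω => (fun (e : {e : Slot m // e ≠ (t, w)}) b => X e.1.1 e.1.2 b ω, fun s w' => U s w' ω))
    (X t w a) P

theorem IsEnvironment.isRewardModel [IsFiniteMeasure P] (h : IsEnvironment P ν X U) :
    IsRewardModel P ν X U where
  measurable_reward := h.measurable_reward
  map_reward := h.map_reward
  measurable_explore := h.measurable_explore
  indep t w a := by
    let T : Set (ℕ × Fin m × Fin k) := {i | (i.1, i.2.1) ≠ (t, w)}
    let R (ω : Ω) (i : ℕ × Fin m × Fin k) : ℝ := X i.1 i.2.1 i.2.2 ω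
    have hR (i : ℕ × Fin m × Fin k) : Measurable fun ω => R ω i := h.measurable_reward _ _ _
    have hrewards : IndepFun (X t w a) (fun ω (i : T) => R ω i) P :=
      indepFun_pi_of_notMem hR h.indep_reward (i := (t, w, a)) fun hmem => hmem rfl
    have hexplore : IndepFun (fun ω => (X t w a ω, fun i : T => R ω i))
        (fun ω (i : ℕ × Fin m) => U i.1 i.2 ω) P :=
      h.indep.comp (φ := fun r => (r (t, w, a), fun i : T => r i)) (by fun_prop) measurable_id
    have hjoint := indepFun_prodMk_of_indepFun (h.measurable_reward t w a)
      (measurable_pi_lambda _ fun i : T => hR i)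
      (measurable_pi_lambda _ fun i : ℕ × Fin m => h.measurable_explore i.1 i.2) hrewards hexplore
    exact (hjoint.comp (φ := id) (ψ := fun q => (fun (e : {e : Slot m // e ≠ (t, w)}) (b : Fin k) =>
      q.1 (⟨(e.1.1, e.1.2, b), e.2⟩ : T), fun (s : ℕ) (w' : Fin m) => q.2 (s, w')))
      measurable_id (by fun_prop)).symm

/-- The realised rewards and exploratory actions. -/
def noise (X : ℕ → Fin m → Fin k → Ω → ℝ) (U : ℕ → Fin m → Ω → Fin k) (ω : Ω) : Noise m k :=
  (fun t w a => X t w a ω, fun t w => U t w ω)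

/-- Replace the rewards of one slot by `0`. -/
def eraseSlot (e : Slot m) (p : Noise m k) : Noise m k :=
  (fun t w => if (t, w) = e then 0 else p.1 t w, p.2)

theorem measurable_eraseSlot (e : Slot m) : Measurable (eraseSlot (k := k) e) := by
  unfold eraseSlot
  refine Measurable.prodMk (measurable_pi_lambda _ fun t => measurable_pi_lambda _ fun w => ?_)
    measurable_snd
  split_ifs <;> fun_prop

theorem eraseSlot_of_ne {e e' : Slot m} (he : e' ≠ e) (p : Noise m k) :
    (eraseSlot e p).1 e'.1 e'.2 = p.1 e'.1 e'.2 :=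
  if_neg he

theorem IsRewardModel.measurable_noise (h : IsRewardModel P ν X U) : Measurable (noise X U) :=
  (measurable_pi_lambda _ fun t => measurable_pi_lambda _ fun w => measurable_pi_lambda _ fun a =>
    h.measurable_reward t w a).prodMk
  (measurable_pi_lambda _ fun t => measurable_pi_lambda _ fun w => h.measurable_explore t w)

theorem IsRewardModel.indepFun_eraseSlot (h : IsRewardModel P ν X U) (e : Slot m) (a : Fin k) :
    IndepFun (fun ω => eraseSlot e (noise X U ω)) (X e.1 e.2 a) P := by
  let rebuild (q : ({e' : Slot m // e' ≠ e} → Fin k → ℝ) × (ℕ → Fin m → Fin k)) : Noise m k :=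
    (fun t w => if he : (t, w) ≠ e then q.1 ⟨(t, w), he⟩ else 0, q.2)
  have hrebuild : Measurable rebuild := by
    refine Measurable.prodMk (measurable_pi_lambda _ fun t => measurable_pi_lambda _ fun w => ?_)
      measurable_snd
    split_ifs <;> fun_prop
  suffices hrebuild_eq : (fun ω => eraseSlot e (noise X U ω)) = rebuild ∘ fun ω =>
      (fun (e' : {e' : Slot m // e' ≠ e}) b => X e'.1.1 e'.1.2 b ω, fun s w => U s w ω) by
    rw [hrebuild_eq]
    exact (h.indep e.1 e.2 a).comp hrebuild measurable_id
  funext ω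
  refine Prod.ext (funext₂ fun t w => ?_) rfl
  by_cases he : (t, w) = e <;> simp [eraseSlot, rebuild, noise, he]

variable {G : SimpleGraph (Fin m)} {v : Fin m} {π : List (Fin k × ℝ) → Fin k}

theorem notMem_of_slots_eq {n : ℕ} {l₁ l₂ : List (Slot m)} {e : Slot m}
    (hl : slots G v n = l₁ ++ e :: l₂) : e ∉ l₁ := by
  have hnodup := nodup_slots (G := G) (v := v) n
  rw [hl, List.nodup_append'] at hnodup
  exact fun he => hnodup.2.2 he List.mem_cons_self

theorem action_eraseSlot (hG : G.Connected) {n : ℕ} {l₁ l₂ : List (Slot m)} {e : Slot m}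
    (hl : slots G v n = l₁ ++ e :: l₂) (p : Noise m k) :
    action G v π (eraseSlot e p).1 p.2 e.1 e.2 = action G v π p.1 p.2 e.1 e.2 :=
  action_congr_of_slots_eq π p.2 hG hl fun _ he' =>
    eraseSlot_of_ne (ne_of_mem_of_not_mem he' (notMem_of_slots_eq hl)) p

theorem arrivals_eraseSlot (hG : G.Connected) {n : ℕ} {l₁ l₂ : List (Slot m)} {e : Slot m}
    (hl : slots G v n = l₁ ++ e :: l₂) (a : Fin k) (p : Noise m k) :
    arrivals G v π a l₁ (eraseSlot e p) = arrivals G v π a l₁ p := by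
  have herase {e' : Slot m} (he' : e' ∈ l₁) :
      (eraseSlot e p).1 e'.1 e'.2 = p.1 e'.1 e'.2 :=
    eraseSlot_of_ne (ne_of_mem_of_not_mem he' (notMem_of_slots_eq hl)) p
  have hfilter : (l₁.filter fun e' => action G v π (eraseSlot e p).1 p.2 e'.1 e'.2 = a)
      = l₁.filter fun e' => action G v π p.1 p.2 e'.1 e'.2 = a := by
    refine List.filter_congr fun e' he' => ?_
    obtain ⟨r, r', rfl⟩ := List.append_of_mem he'
    rw [action_congr_of_slots_eq (l₂ := r' ++ e :: l₂) π p.2 hG (by simpa using hl)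
      fun e'' he'' => herase (List.mem_append_left _ he'')]
  unfold arrivals
  rw [show (eraseSlot e p).2 = p.2 from rfl, hfilter]
  exact List.map_congr_left fun e' he' => congrFun (herase (List.mem_of_mem_filter he')) a

theorem weight_ofFn (f : ℕ → ℝ → ENNReal) {j : ℕ} (y : Fin j → ℝ) :
    weight f (List.ofFn y) = ∏ i : Fin j, f i (y i) := by
  rw [weight, List.length_ofFn, Finset.prod_range]
  exact Finset.prod_congr rfl fun i _ => by simp

theorem measurable_weight_arrivals (hπ : MeasurablePolicy π) (a : Fin k) {f : ℕ → ℝ → ENNReal}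
    (hf : ∀ i, Measurable (f i)) (l : List (Slot m)) :
    Measurable fun p : Noise m k => weight f (arrivals G v π a l p) := by
  refine measurable_comp_arrivals hπ a l fun j => ?_
  simp_rw [weight_ofFn]
  exact Finset.measurable_prod _ fun i _ => (hf i).comp (measurable_pi_apply i)

variable [IsProbabilityMeasure P]

/-- The reward of a slot is independent of the rewards that arrived before it and of the decision to
play `a` there, so each factor of the weight has conditional expectation at most `1`. -/
theorem lintegral_weight_append_le (hX : IsRewardModel P ν X U) (hG : G.Connected)
    (hπ : MeasurablePolicy π) {a : Fin k} {f : ℕ → ℝ → ENNReal} (hf : ∀ i, Measurable (f i))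
    (hf1 : ∀ i, ∫⁻ y, f i y ∂ν a ≤ 1) {n : ℕ} {l₁ l₂ : List (Slot m)} {e : Slot m}
    (hl : slots G v n = l₁ ++ e :: l₂) :
    ∫⁻ ω, weight f (arrivals G v π a (l₁ ++ [e]) (noise X U ω)) ∂P
      ≤ ∫⁻ ω, weight f (arrivals G v π a l₁ (noise X U ω)) ∂P := by
  let factor (p : Noise m k) (y : ℝ) : ENNReal :=
    if action G v π p.1 p.2 e.1 e.2 = a then f (arrivals G v π a l₁ p).length y else 1
  have hfactor : Measurable (Function.uncurry factor) := by
    refine Measurable.ite (measurableSet_eq_fun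
      ((measurable_action hπ e.1 e.2).comp measurable_fst) measurable_const) ?_ measurable_const
    exact measurable_bind (g := fun (q : Noise m k × ℝ) j => f j q.2)
      ((measurable_comp_arrivals hπ a l₁ (g := List.length) fun j => by
        simp only [List.length_ofFn, measurable_const]).comp measurable_fst)
      fun j => (hf j).comp measurable_snd
  have hfactor1 (p : Noise m k) : ∫⁻ y, factor p y ∂P.map (X e.1 e.2 a) ≤ 1 := by
    have : IsProbabilityMeasure (P.map (X e.1 e.2 a)) :=
      Measure.isProbabilityMeasure_map (hX.measurable_reward e.1 e.2 a).aemeasurable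
    simp only [factor]
    split_ifs
    · exact (hX.map_reward e.1 e.2 a).symm ▸ hf1 _
    · rw [lintegral_one, measure_univ]
  have hstep (ω : Ω) : weight f (arrivals G v π a (l₁ ++ [e]) (noise X U ω))
      = weight f (arrivals G v π a l₁ (eraseSlot e (noise X U ω)))
        * factor (eraseSlot e (noise X U ω)) (X e.1 e.2 a ω) := by
    simp only [factor]
    rw [arrivals_append_singleton, arrivals_eraseSlot hG hl, show (eraseSlot e (noise X U ω)).2
      = (noise X U ω).2 from rfl, action_eraseSlot hG hl]
    split_ifs
    · rw [weight_append_singleton]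
      rfl
    · rw [List.append_nil, mul_one]
  have h := lintegral_mul_le_of_indepFun ((measurable_eraseSlot e).comp hX.measurable_noise)
    (hX.measurable_reward e.1 e.2 a) (hX.indepFun_eraseSlot e a)
    (measurable_weight_arrivals (G := G) (v := v) hπ a hf l₁) hfactor hfactor1
  simpa only [hstep, Function.comp_apply, arrivals_eraseSlot hG hl] using h

theorem lintegral_weight_le_one (hX : IsRewardModel P ν X U) (hG : G.Connected)
    (hπ : MeasurablePolicy π) {a : Fin k} {f : ℕ → ℝ → ENNReal} (hf : ∀ i, Measurable (f i))
    (hf1 : ∀ i, ∫⁻ y, f i y ∂ν a ≤ 1) {n : ℕ} {l₁ l₂ : List (Slot m)}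
    (hl : slots G v n = l₁ ++ l₂) :
    ∫⁻ ω, weight f (arrivals G v π a l₁ (noise X U ω)) ∂P ≤ 1 := by
  induction l₁ using List.reverseRecOn generalizing l₂ with
  | nil => simp [arrivals, weight]
  | append_singleton l e ih =>
    have hcons : slots G v n = l ++ e :: l₂ := by rw [hl, List.append_assoc, List.singleton_append]
    exact (lintegral_weight_append_le hX hG hπ hf hf1 hcons).trans (ih hcons)

theorem measure_deviation_le {a : Fin k} [IsProbabilityMeasure (ν a)] (hX : IsRewardModel P ν X U)
    (hG : G.Connected) (hπ : MeasurablePolicy π) {ε σ : ℝ} (hε : 0 < ε) (hε1 : ε ≤ 1) (hσ : 0 < σ)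
    (hν : MomentBound (ν a) ε σ) {δ κ : ℝ} (hδ0 : 0 < δ) (hδ1 : δ < 1) (hκ : |κ| = 1)
    {s : ℕ} (hs : s ≠ 0) (n : ℕ) :
    P {ω | s ≤ (arrivals G v π a (slots G v n) (noise X U ω)).length ∧
      4 * width ε σ (Real.log (1 / δ)) s
        ≤ κ * (truncatedMean ε σ δ ((arrivals G v π a (slots G v n) (noise X U ω)).take s)
          - mean ν a)} ≤ ENNReal.ofReal δ := by
  have hL : 0 < Real.log (1 / δ) := Real.log_pos (one_lt_one_div hδ0 hδ1)
  have hf := measurable_deviationWeight (ν a) ε σ (Real.log (1 / δ)) κ s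
  set W := fun ω => weight (deviationWeight (ν a) ε σ (Real.log (1 / δ)) κ s)
    (arrivals G v π a (slots G v n) (noise X U ω))
  have hWm : Measurable W := (measurable_weight_arrivals hπ a hf _).comp hX.measurable_noise
  calc _ ≤ P {ω | ENNReal.ofReal (1 / δ) ≤ W ω} := measure_mono fun ω hω =>
        hν.one_div_le_weight_of_deviation hε hε1 hσ hκ hδ0 hδ1 hs hω.1 hω.2
    _ ≤ (∫⁻ ω, W ω ∂P) / ENNReal.ofReal (1 / δ) :=
        meas_ge_le_lintegral_div hWm.aemeasurable (by simpa using hδ0) ENNReal.ofReal_ne_top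
    _ ≤ 1 / ENNReal.ofReal (1 / δ) := by
        gcongr
        exact lintegral_weight_le_one hX hG hπ hf
          (lintegral_deviationWeight_le_one hν hε hε1 hσ hL hκ s) (List.append_nil _).symm
    _ = ENNReal.ofReal δ := by
        rw [one_div, ← ENNReal.ofReal_inv_of_pos (one_div_pos.2 hδ0), one_div, inv_inv]

end RewardModel

/-! ### Gaps -/

section Gap

variable {k : ℕ} {ν : Fin k → Measure ℝ} {ε σ : ℝ}

theorem gap_nonneg (ν : Fin k → Measure ℝ) (a : Fin k) : 0 ≤ gap ν a :=
  sub_nonneg.2 (le_ciSup (Set.finite_range _).bddAbove a)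

theorem mem_subopt {a : Fin k} : a ∈ subopt ν ↔ 0 < gap ν a := by
  simp [subopt]

theorem exists_mean_eq_add_gap (ν : Fin k → Measure ℝ) (a : Fin k) :
    ∃ b, mean ν b = mean ν a + gap ν a := by
  have : Nonempty (Fin k) := ⟨a⟩
  obtain ⟨b, hb⟩ := exists_eq_ciSup_of_finite (f := mean ν)
  exact ⟨b, by rw [hb, gap, add_sub_cancel]⟩

theorem gap_le_two_mul [∀ a, IsProbabilityMeasure (ν a)] (hε : 0 < ε)
    (hν : ∀ a, MomentBound (ν a) ε σ) (a : Fin k) : gap ν a ≤ 2 * σ ^ (1 / (1 + ε)) := by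
  obtain ⟨b, hb⟩ := exists_mean_eq_add_gap ν a
  have ha : -σ ^ (1 / (1 + ε)) ≤ mean ν a := (abs_le.1 ((hν a).abs_integral_le hε)).1
  have hb' : mean ν b ≤ σ ^ (1 / (1 + ε)) := (abs_le.1 ((hν b).abs_integral_le hε)).2
  linarith

theorem pos_of_gap_pos [∀ a, IsProbabilityMeasure (ν a)] (hε : 0 < ε)
    (hν : ∀ a, MomentBound (ν a) ε σ) {a : Fin k} (ha : 0 < gap ν a) : 0 < σ := by
  have hσ : 0 ≤ σ := (integral_nonneg fun x => by positivity).trans (hν a).integral_le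
  refine hσ.lt_of_ne fun hσ0 => ?_
  have hgap := gap_le_two_mul hε hν a
  rw [← hσ0, Real.zero_rpow (by positivity), mul_zero] at hgap
  exact ha.not_ge hgap

end Gap

/-! ### Selections of the robust upper confidence bound algorithm -/

section Selection

variable {k : ℕ} {β : Type*} {ε σ : ℝ} {ν : Fin k → Measure ℝ}

theorem length_tagSamples_le (h : List (Fin k × β)) (a : Fin k) :
    (tagSamples h a).length ≤ h.length :=
  List.length_filterMap_le _ _

theorem length_tagSamples_le_add_card {h : List (Fin k × β)} {a : Fin k} {bad : ℕ → Prop}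
    [DecidablePred bad] {s₀ : ℝ} (hs₀ : 0 ≤ s₀)
    (hbad : ∀ l p, l ++ [p] <+: h → p.1 = a → s₀ < (tagSamples l a).length →
      bad (l.length + 1)) :
    ((tagSamples h a).length : ℝ)
      ≤ s₀ + 1 + ((Finset.Ico 2 (h.length + 1)).filter bad).card := by
  induction h using List.reverseRecOn with
  | nil =>
    rw [show (tagSamples [] a : List β).length = 0 from rfl, Nat.cast_zero]
    positivity
  | append_singleton l p ih =>
    have ih := ih fun l' p' hl' => hbad l' p' (hl'.trans (List.prefix_append _ _))
    rw [tagSamples_append, tagSamples_singleton, List.length_append, List.length_append,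
      List.length_singleton]
    have hmono : (Finset.Ico 2 (l.length + 1)).filter bad
        ⊆ (Finset.Ico 2 (l.length + 1 + 1)).filter bad := by gcongr; omega
    by_cases hp : p.1 = a
    · rw [if_pos hp, List.length_singleton, Nat.cast_add, Nat.cast_one]
      rcases le_or_gt ((tagSamples l a).length : ℝ) s₀ with hle | hlt
      · have : (0 : ℝ) ≤ ((Finset.Ico 2 (l.length + 1 + 1)).filter bad).card := by positivity
        linarith
      · have hlen : 2 ≤ l.length + 1 := by
          have hpos : 0 < (tagSamples l a).length := by exact_mod_cast hs₀.trans_lt hlt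
          have := length_tagSamples_le l a
          omega
        rw [← Finset.insert_Ico_right_eq_Ico_add_one hlen, Finset.filter_insert,
          if_pos (hbad l p (List.prefix_refl _) hp hlt), Finset.card_insert_of_notMem (by simp)]
        push_cast
        linarith
    · rw [if_neg hp, List.length_nil, add_zero]
      have : (((Finset.Ico 2 (l.length + 1)).filter bad).card : ℝ)
        ≤ ((Finset.Ico 2 (l.length + 1 + 1)).filter bad).card := by gcongr
      linarith

/-- The confidence bound of round `t` fails in the direction `κ = ±1` for some prefix of `xs` of
length less than `t`. Quantifying over all lengths makes this an event about the rewards alone,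
whatever number of them has been fed by round `t`. -/
def Deviates (ε σ κ μ : ℝ) (t : ℕ) (xs : List ℝ) : Prop :=
  ∃ s ∈ Finset.Ico 1 t, s ≤ xs.length ∧
    4 * width ε σ (Real.log ((t : ℝ) ^ 2)) s
      ≤ κ * (truncatedMean ε σ (1 / (t : ℝ) ^ 2) (xs.take s) - μ)

theorem lt_of_not_deviates {κ μ : ℝ} {h : List (Fin k × ℝ)} {a : Fin k} {xs : List ℝ}
    (hxs : samples h a <+: xs) (hpos : (samples h a).length ≠ 0)
    (hdev : ¬Deviates ε σ κ μ (h.length + 1) xs) :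
    κ * (truncatedMean ε σ (1 / ((h.length : ℝ) + 1) ^ 2) (samples h a) - μ)
      < 4 * width ε σ (Real.log (((h.length : ℝ) + 1) ^ 2)) (samples h a).length := by
  by_contra! hle
  refine hdev ⟨(samples h a).length, Finset.mem_Ico.2 ⟨Nat.one_le_iff_ne_zero.2 hpos,
    Nat.lt_succ_of_le (length_tagSamples_le h a)⟩, hxs.length_le, ?_⟩
  rwa [← List.prefix_iff_eq_take.1 hxs, Nat.cast_add_one]

theorem robustIndex_eq {h : List (Fin k × ℝ)} {a : Fin k} (hpos : (samples h a).length ≠ 0) :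
    robustIndex ε σ h a = ((truncatedMean ε σ (1 / ((h.length : ℝ) + 1) ^ 2) (samples h a)
      + 4 * width ε σ (Real.log (((h.length : ℝ) + 1) ^ 2)) (samples h a).length : ℝ) : EReal) := by
  rw [robustIndex, if_neg hpos, width, mul_assoc]

theorem deviates_or_deviates_of_select {π : List (Fin k × ℝ) → Fin k} (hπ : IsRobustUCB ε σ π)
    {h : List (Fin k × ℝ)} {a b : Fin k} (ha : π h = a) (hpos : (samples h a).length ≠ 0)
    (hb : mean ν b = mean ν a + gap ν a)
    (hwidth : 8 * width ε σ (Real.log (((h.length : ℝ) + 1) ^ 2)) (samples h a).length < gap ν a)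
    {xa xb : List ℝ} (hxa : samples h a <+: xa) (hxb : samples h b <+: xb) :
    Deviates ε σ 1 (mean ν a) (h.length + 1) xa ∨
      Deviates ε σ (-1) (mean ν b) (h.length + 1) xb := by
  have hindex : robustIndex ε σ h b ≤ robustIndex ε σ h a := ha ▸ hπ h b
  rw [robustIndex_eq hpos] at hindex
  have hposb : (samples h b).length ≠ 0 := fun h0 => by
    rw [robustIndex, if_pos h0] at hindex
    exact hindex.not_gt (EReal.coe_lt_top _)
  rw [robustIndex_eq hposb, EReal.coe_le_coe_iff] at hindex
  by_contra! hnot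
  have hupper := lt_of_not_deviates hxa hpos hnot.1
  have hlower := lt_of_not_deviates hxb hposb hnot.2
  linarith

theorem eight_mul_width_lt (hε : 0 < ε) (hσ : 0 < σ) {L M Δ : ℝ} (hL : 0 ≤ L) (hLM : L ≤ M)
    (hΔ : 0 < Δ) {r : ℝ} (hr : M * (8 * σ ^ (1 / (1 + ε)) / Δ) ^ ((1 + ε) / ε) < r) :
    8 * width ε σ L r < Δ := by
  set K := 8 * σ ^ (1 / (1 + ε)) / Δ
  have hK : 0 < K := by positivity
  have hr0 : 0 < r := (mul_nonneg (hL.trans hLM) (by positivity)).trans_lt hr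
  have hratio : L / r < K⁻¹ ^ ((1 + ε) / ε) := by
    rw [Real.inv_rpow hK.le, div_lt_iff₀ hr0, inv_mul_eq_div, lt_div_iff₀ (by positivity)]
    exact (mul_le_mul_of_nonneg_right hLM (by positivity)).trans_lt hr
  calc 8 * width ε σ L r = K * Δ * (L / r) ^ (ε / (1 + ε)) := by
        rw [width, ← mul_assoc, div_mul_cancel₀ _ hΔ.ne']
    _ < K * Δ * (K⁻¹ ^ ((1 + ε) / ε)) ^ (ε / (1 + ε)) := by gcongr
    _ = Δ := by
        rw [← Real.rpow_mul (by positivity), div_mul_div_cancel₀ hε.ne', div_self (by positivity),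
          Real.rpow_one, mul_right_comm, mul_inv_cancel₀ hK.ne', one_mul]

open scoped Classical in
theorem length_tagSamples_le_of_isRobustUCB {π : List (Fin k × ℝ) → Fin k}
    (hπ : IsRobustUCB ε σ π) (hε : 0 < ε) (hσ : 0 < σ) {f : Fin k → β → ℝ}
    {h : List (Fin k × β)} (hfollows : Follows (tagPolicy π f) h) {N : ℕ} (hN : h.length ≤ N)
    {a b : Fin k} (hgap : 0 < gap ν a) (hb : mean ν b = mean ν a + gap ν a) {xa xb : List ℝ}
    (hxa : (tagSamples h a).map (f a) <+: xa) (hxb : (tagSamples h b).map (f b) <+: xb) :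
    ((tagSamples h a).length : ℝ)
      ≤ 2 * Real.log N * (8 * σ ^ (1 / (1 + ε)) / gap ν a) ^ ((1 + ε) / ε) + 1
        + ((Finset.Ico 2 (N + 1)).filter fun t =>
          Deviates ε σ 1 (mean ν a) t xa ∨ Deviates ε σ (-1) (mean ν b) t xb).card := by
  have hs₀ : 0 ≤ 2 * Real.log N * (8 * σ ^ (1 / (1 + ε)) / gap ν a) ^ ((1 + ε) / ε) := by
    have := Real.log_natCast_nonneg N
    positivity
  refine (length_tagSamples_le_add_card (bad := fun t => Deviates ε σ 1 (mean ν a) t xa ∨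
    Deviates ε σ (-1) (mean ν b) t xb) hs₀ fun l p hl hpa hlong => ?_).trans (by gcongr)
  have hprefix (c : Fin k) : samples (revealHist f l) c <+: (tagSamples h c).map (f c) := by
    rw [samples_revealHist]
    exact (((List.prefix_append l [p]).trans hl).filterMap _).map _
  have hlen : l.length + 1 ≤ N := by simpa using hl.length_le.trans hN
  have hreveal : (revealHist f l).length = l.length := List.length_map _
  have hcount : (samples (revealHist f l) a).length = (tagSamples l a).length := by
    rw [samples_revealHist, List.length_map]
  rw [← hreveal]
  refine deviates_or_deviates_of_select hπ ((hfollows l p hl).symm.trans hpa) ?_ hb ?_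
    ((hprefix a).trans hxa) ((hprefix b).trans hxb)
  · rw [hcount]
    exact_mod_cast (hs₀.trans_lt hlong).ne'
  · rw [hcount, hreveal]
    refine eight_mul_width_lt hε hσ (Real.log_nonneg (one_le_pow₀ (by simp))) ?_ hgap hlong
    rw [Real.log_pow, Nat.cast_ofNat]
    gcongr
    exact_mod_cast hlen

end Selection

/-! ### Expected number of plays -/

section Regret

variable {m k : ℕ} {ε σ : ℝ} {ν : Fin k → Measure ℝ} {Ω : Type*} [MeasurableSpace Ω]
  {P : Measure Ω} {X : ℕ → Fin m → Fin k → Ω → ℝ} {U : ℕ → Fin m → Ω → Fin k}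
  {G : SimpleGraph (Fin m)} {v : Fin m} {π : List (Fin k × ℝ) → Fin k}

theorem sum_one_div_le_log {N : ℕ} (hN : 1 ≤ N) :
    ∑ t ∈ Finset.Ico 2 (N + 1), 1 / (t : ℝ) ≤ Real.log N := by
  have h := harmonic_le_one_add_log N
  rw [harmonic_eq_sum_Icc, ← Finset.Ico_add_one_right_eq_Icc,
    Finset.sum_eq_sum_Ico_succ_bot (by omega)] at h
  push_cast at h
  simpa only [one_div, inv_one, one_add_one_eq_two, add_le_add_iff_left] using h

theorem mul_rpow_div_eq (hε : 0 < ε) (hσ : 0 ≤ σ) {Δ c : ℝ} (hΔ : 0 < Δ) (hc : 0 ≤ c) :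
    Δ * (c * σ ^ (1 / (1 + ε)) / Δ) ^ ((1 + ε) / ε)
      = c ^ ((1 + ε) / ε) * (σ ^ (1 / ε) / Δ ^ (1 / ε)) := by
  rw [Real.div_rpow (by positivity) hΔ.le, Real.mul_rpow hc (by positivity),
    ← Real.rpow_mul hσ, show 1 / (1 + ε) * ((1 + ε) / ε) = 1 / ε by field_simp,
    show (1 + ε) / ε = 1 / ε + 1 by field_simp, Real.rpow_add hΔ, Real.rpow_one]
  field_simp

theorem mul_saturation_add_le (hε : 0 < ε) (hσ : 0 ≤ σ) {Δ ℓ D : ℝ} (hΔ : 0 < Δ)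
    (hΔσ : Δ ≤ 8 * σ ^ (1 / (1 + ε))) (hℓ : 1 ≤ 2 * ℓ) (hD : 0 ≤ D) :
    Δ * (2 * ℓ * (8 * σ ^ (1 / (1 + ε)) / Δ) ^ ((1 + ε) / ε) + 1 + 2 * D + 2 * ℓ)
      ≤ (6 * 8 ^ ((1 + ε) / ε) + 2) * (σ ^ (1 / ε) * ℓ / Δ ^ (1 / ε) + D * Δ) := by
  have hscale := mul_rpow_div_eq hε hσ hΔ (c := 8) (by norm_num)
  have hΔle : Δ ≤ 8 ^ ((1 + ε) / ε) * (σ ^ (1 / ε) / Δ ^ (1 / ε)) := by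
    rw [← hscale]
    exact le_mul_of_one_le_right hΔ.le
      (Real.one_le_rpow ((one_le_div hΔ).2 hΔσ) (by positivity))
  have hℓ0 : 0 < ℓ := by linarith
  rw [mul_div_right_comm (σ ^ (1 / ε))]
  set E : ℝ := 8 ^ ((1 + ε) / ε)
  set R := σ ^ (1 / ε) / Δ ^ (1 / ε)
  have : 0 < E := by positivity
  have : 0 ≤ R := by positivity
  calc Δ * (2 * ℓ * (8 * σ ^ (1 / (1 + ε)) / Δ) ^ ((1 + ε) / ε) + 1 + 2 * D + 2 * ℓ)
      = 2 * ℓ * (Δ * (8 * σ ^ (1 / (1 + ε)) / Δ) ^ ((1 + ε) / ε)) + Δ * (1 + 2 * ℓ)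
        + 2 * (D * Δ) := by ring
    _ ≤ 2 * ℓ * (E * R) + E * R * (4 * ℓ) + 2 * (D * Δ) := by
        rw [hscale]
        gcongr
        linarith
    _ ≤ (6 * E + 2) * (R * ℓ + D * Δ) := by
        have hRℓ : 0 ≤ R * ℓ := by positivity
        have hEDΔ : 0 ≤ E * (D * Δ) := by positivity
        linarith

theorem measurable_truncatedMean_take {δ : ℝ} {s j : ℕ} (hs : s ≤ j) :
    Measurable fun y : Fin j → ℝ => truncatedMean ε σ δ ((List.ofFn y).take s) := by
  simp_rw [truncatedMean_take (hs.trans_eq List.length_ofFn.symm)]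
  refine (Finset.measurable_sum _ fun i hi => (measurable_trunc _).comp ?_).div_const _
  have hij : i < j := (Finset.mem_range.1 hi).trans_le hs
  simpa [List.getD_eq_getElem?_getD, hij] using measurable_pi_apply (⟨i, hij⟩ : Fin j)

theorem measurableSet_deviates (hX : IsRewardModel P ν X U) (hπ : MeasurablePolicy π)
    (κ μ : ℝ) (t : ℕ) (a : Fin k) (l : List (Slot m)) :
    MeasurableSet {ω | Deviates ε σ κ μ t (arrivals G v π a l (noise X U ω))} := by
  have hlist (j : ℕ) : MeasurableSet {y : Fin j → ℝ | Deviates ε σ κ μ t (List.ofFn y)} := by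
    have hunion : {y : Fin j → ℝ | Deviates ε σ κ μ t (List.ofFn y)}
        = ⋃ s ∈ (Finset.Ico 1 t).filter (· ≤ j), {y | 4 * width ε σ (Real.log ((t : ℝ) ^ 2)) s
          ≤ κ * (truncatedMean ε σ (1 / (t : ℝ) ^ 2) ((List.ofFn y).take s) - μ)} := by
      ext y
      simp [Deviates, and_assoc]
    rw [hunion]
    exact Finset.measurableSet_biUnion _ fun s hs => measurableSet_le measurable_const
      (((measurable_truncatedMean_take (Finset.mem_filter.1 hs).2).sub_const μ).const_mul κ)
  exact measurableSet_setOfPred.2 ((measurable_comp_arrivals hπ a l (g := Deviates ε σ κ μ t)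
    fun j => measurableSet_setOfPred.1 (hlist j)).comp hX.measurable_noise)

variable [IsProbabilityMeasure P]

theorem measureReal_deviates_le {a : Fin k} [IsProbabilityMeasure (ν a)]
    (hX : IsRewardModel P ν X U) (hG : G.Connected) (hπ : MeasurablePolicy π) (hε : 0 < ε)
    (hε1 : ε ≤ 1) (hσ : 0 < σ) (hν : MomentBound (ν a) ε σ) {κ : ℝ} (hκ : |κ| = 1) (n : ℕ) {t : ℕ}
    (ht : 2 ≤ t) :
    P.real {ω | Deviates ε σ κ (mean ν a) t (arrivals G v π a (slots G v n) (noise X U ω))}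
      ≤ 1 / t := by
  have ht1 : (1 : ℝ) < (t : ℝ) ^ 2 := one_lt_pow₀ (by exact_mod_cast ht) two_ne_zero
  have hδ0 : 0 < 1 / (t : ℝ) ^ 2 := by positivity
  have hδ1 : 1 / (t : ℝ) ^ 2 < 1 := (div_lt_one (by positivity)).2 ht1
  have hlength (s : ℕ) (hs : s ∈ Finset.Ico 1 t) := measure_deviation_le (v := v) hX hG hπ hε hε1
    hσ hν hδ0 hδ1 hκ (Nat.one_le_iff_ne_zero.1 (Finset.mem_Ico.1 hs).1) n
  rw [one_div_one_div] at hlength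
  have hunion : {ω | Deviates ε σ κ (mean ν a) t (arrivals G v π a (slots G v n) (noise X U ω))}
      = ⋃ s ∈ Finset.Ico 1 t, {ω | s ≤ (arrivals G v π a (slots G v n) (noise X U ω)).length ∧
        4 * width ε σ (Real.log ((t : ℝ) ^ 2)) s ≤ κ * (truncatedMean ε σ (1 / (t : ℝ) ^ 2)
          ((arrivals G v π a (slots G v n) (noise X U ω)).take s) - mean ν a)} := by
    ext ω
    simp only [Deviates, Set.mem_ofPred_eq, Set.mem_iUnion, exists_prop]
  rw [hunion]
  calc _ ≤ ∑ _s ∈ Finset.Ico 1 t, 1 / (t : ℝ) ^ 2 :=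
        (measureReal_biUnion_finset_le _ _).trans
          (Finset.sum_le_sum fun s hs => ENNReal.toReal_le_of_le_ofReal hδ0.le (hlength s hs))
    _ = ((t - 1 : ℕ) : ℝ) * (1 / (t : ℝ) ^ 2) := by
        rw [Finset.sum_const, Nat.card_Ico, nsmul_eq_mul]
    _ ≤ t * (1 / (t : ℝ) ^ 2) := by gcongr; omega
    _ = 1 / t := by field_simp

theorem integral_le_add_sum_measureReal {f : Ω → ℝ} (hf0 : ∀ ω, 0 ≤ f ω) {c : ℝ} {I : Finset ℕ}
    {E : ℕ → Set Ω} (hE : ∀ t, MeasurableSet (E t)) [∀ ω, DecidablePred fun t => ω ∈ E t]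
    (hf : ∀ ω, f ω ≤ c + (I.filter fun t => ω ∈ E t).card) :
    ∫ ω, f ω ∂P ≤ c + ∑ t ∈ I, P.real (E t) := by
  have hind (t : ℕ) : Integrable ((E t).indicator (1 : Ω → ℝ)) P :=
    (integrable_const (1 : ℝ)).indicator (hE t)
  calc ∫ ω, f ω ∂P ≤ ∫ ω, (c + ∑ t ∈ I, (E t).indicator 1 ω) ∂P := by
        refine integral_mono_of_nonneg (.of_forall hf0)
          ((integrable_const c).add (integrable_finsetSum _ fun t _ => hind t))
          (.of_forall fun ω => (hf ω).trans_eq ?_)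
        simp only [Set.indicator_apply, Pi.one_apply, Finset.sum_boole]
    _ = c + ∑ t ∈ I, P.real (E t) := by
        rw [integral_add (integrable_const c) (integrable_finsetSum _ fun t _ => hind t),
          integral_finsetSum _ fun t _ => hind t, integral_const, probReal_univ, one_smul]
        simp_rw [integral_indicator_one (hE _)]

open scoped Classical in
theorem sum_plays_le_of_isRobustUCB (hG : G.Connected) (hπ : IsRobustUCB ε σ π) (hε : 0 < ε)
    (hσ : 0 < σ) (n : ℕ) {a b : Fin k} (hgap : 0 < gap ν a) (hb : mean ν b = mean ν a + gap ν a)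
    (p : Noise m k) :
    ∑ w, (plays G v π p.1 p.2 n w a : ℝ)
      ≤ 2 * Real.log (m * n : ℕ) * (8 * σ ^ (1 / (1 + ε)) / gap ν a) ^ ((1 + ε) / ε) + 1
        + 2 * ∑ w, (G.dist v w : ℝ) + ((Finset.Ico 2 (m * n + 1)).filter fun t =>
          Deviates ε σ 1 (mean ν a) t (arrivals G v π a (slots G v n) p) ∨
            Deviates ε σ (-1) (mean ν b) t (arrivals G v π b (slots G v n) p)).card := by
  have hprefix (c : Fin k) : (tagSamples (tagRun G v π p.1 p.2 n).hist c).map (rewardAt p.1 c)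
      <+: arrivals G v π c (slots G v n) p := by
    rw [arrivals, ← samples_append_queue π p.1 p.2 hG]
    exact (List.prefix_append _ _).map _
  have hfed := length_tagSamples_le_of_isRobustUCB hπ hε hσ (tagRun_follows G v π p.1 p.2 n)
    (length_hist_le π p.1 p.2 hG n) hgap hb (hprefix a) (hprefix b)
  have hplays : ∑ w, (plays G v π p.1 p.2 n w a : ℝ)
      ≤ (tagSamples (tagRun G v π p.1 p.2 n).hist a).length + 2 * ∑ w, (G.dist v w : ℝ) := by
    exact_mod_cast sum_plays_le (v := v) π p.1 p.2 hG n a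
  linarith

theorem integral_plays_le [∀ a, IsProbabilityMeasure (ν a)] (hX : IsRewardModel P ν X U)
    (hG : G.Connected) (hπm : MeasurablePolicy π) (hπ : IsRobustUCB ε σ π) (hε : 0 < ε)
    (hε1 : ε ≤ 1) (hν : ∀ a, MomentBound (ν a) ε σ) {n : ℕ} (hmn : 1 ≤ m * n) {a : Fin k}
    (hgap : 0 < gap ν a) :
    ∫ ω, ∑ w, (plays G v π (fun t w a => X t w a ω) (fun t w => U t w ω) n w a : ℝ) ∂P
      ≤ 2 * Real.log (m * n : ℕ) * (8 * σ ^ (1 / (1 + ε)) / gap ν a) ^ ((1 + ε) / ε) + 1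
        + 2 * ∑ w, (G.dist v w : ℝ) + 2 * Real.log (m * n : ℕ) := by
  classical
  have hσ : 0 < σ := pos_of_gap_pos hε hν hgap
  obtain ⟨b, hb⟩ := exists_mean_eq_add_gap ν a
  let D (κ : ℝ) (c : Fin k) (t : ℕ) : Set Ω :=
    {ω | Deviates ε σ κ (mean ν c) t (arrivals G v π c (slots G v n) (noise X U ω))}
  have hD (t : ℕ) (ht : t ∈ Finset.Ico 2 (m * n + 1)) {κ : ℝ} (hκ : |κ| = 1) (c : Fin k) :
      P.real (D κ c t) ≤ 1 / t :=
    measureReal_deviates_le hX hG hπm hε hε1 hσ (hν c) hκ n (Finset.mem_Ico.1 ht).1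
  refine (integral_le_add_sum_measureReal (E := fun t => D 1 a t ∪ D (-1) b t)
    (fun ω => by positivity)
    (fun t => (measurableSet_deviates hX hπm _ _ t a _).union
      (measurableSet_deviates hX hπm _ _ t b _))
    fun ω => sum_plays_le_of_isRobustUCB hG hπ hε hσ n hgap hb (noise X U ω)).trans ?_
  gcongr
  calc ∑ t ∈ Finset.Ico 2 (m * n + 1), P.real (D 1 a t ∪ D (-1) b t)
    _ ≤ ∑ t ∈ Finset.Ico 2 (m * n + 1), 2 * (1 / (t : ℝ)) := Finset.sum_le_sum fun t ht => by
        have ha := hD t ht abs_one a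
        have hb := hD t ht (κ := -1) (by simp) b
        linarith [measureReal_union_le (μ := P) (D 1 a t) (D (-1) b t)]
    _ ≤ 2 * Real.log (m * n : ℕ) := by
        rw [← Finset.mul_sum]
        gcongr
        exact sum_one_div_le_log hmn

theorem gap_mul_integral_plays_le [∀ a, IsProbabilityMeasure (ν a)] (hX : IsRewardModel P ν X U)
    (hG : G.Connected) (hπm : MeasurablePolicy π) (hπ : IsRobustUCB ε σ π) (hε : 0 < ε)
    (hε1 : ε ≤ 1) (hν : ∀ a, MomentBound (ν a) ε σ) {n : ℕ} (hmn : 2 ≤ m * n) {a : Fin k}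
    (hgap : 0 < gap ν a) :
    gap ν a *
        ∫ ω, ∑ w, (plays G v π (fun t w a => X t w a ω) (fun t w => U t w ω) n w a : ℝ) ∂P
      ≤ (6 * 8 ^ ((1 + ε) / ε) + 2) * (σ ^ (1 / ε) * Real.log (m * n) / gap ν a ^ (1 / ε)
        + (∑ w, (G.dist v w : ℝ)) * gap ν a) := by
  have hσ : 0 < σ := pos_of_gap_pos hε hν hgap
  have hgapσ : gap ν a ≤ 8 * σ ^ (1 / (1 + ε)) :=
    (gap_le_two_mul hε hν a).trans (by gcongr; norm_num)
  have hlog : 1 ≤ 2 * Real.log ((m : ℝ) * n) := by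
    have hmono : Real.log 2 ≤ Real.log ((m : ℝ) * n) :=
      Real.log_le_log two_pos (by exact_mod_cast hmn)
    linarith [Real.log_two_gt_d9]
  have hplays := integral_plays_le (v := v) hX hG hπm hπ hε hε1 hν (one_le_two.trans hmn) hgap
  rw [Nat.cast_mul] at hplays
  exact (mul_le_mul_of_nonneg_left hplays hgap.le).trans
    (mul_saturation_add_le hε hσ.le hgap hgapσ hlog (by positivity))

end Regret

end Quack

end

theorem mainTheorem3_general (ε : ℝ) (hε : 0 < ε) (hε1 : ε ≤ 1) :
    ∃ C : ℝ, 0 < C ∧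
      ∀ (Ω : Type*) [MeasurableSpace Ω] (P : Measure Ω) [IsProbabilityMeasure P]
        (m k n : ℕ) (_hmn : 2 ≤ m * n)
        (G : SimpleGraph (Fin m)) (_hG : G.Connected) (v : Fin m)
        (σ : ℝ) (ν : Fin k → Measure ℝ) [∀ a, IsProbabilityMeasure (ν a)]
        (_hν : ∀ a, Quack.MomentBound (ν a) ε σ)
        (X : ℕ → Fin m → Fin k → Ω → ℝ) (U : ℕ → Fin m → Ω → Fin k)
        (_hX : Quack.IsRewardModel P ν X U)
        (π : List (Fin k × ℝ) → Fin k) (_hπm : Quack.MeasurablePolicy π)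
        (_hπ : Quack.IsRobustUCB ε σ π),
        Quack.groupRegret P ν X U G v π n ≤
          C * ((∑ a ∈ Quack.subopt ν,
                  σ ^ (1 / ε) * Real.log ((m : ℝ) * n) / Quack.gap ν a ^ (1 / ε))
              + (∑ w, (G.dist v w : ℝ)) * ∑ a ∈ Quack.subopt ν, Quack.gap ν a) := by
  refine ⟨6 * 8 ^ ((1 + ε) / ε) + 2, by positivity, ?_⟩
  intro Ω _ P _ m k n hmn G hG v σ ν _ hν X U hX π hπm hπ
  have hopt (a : Fin k) (ha : a ∉ Quack.subopt ν) : Quack.gap ν a = 0 :=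
    le_antisymm (not_lt.1 (mt Quack.mem_subopt.2 ha)) (Quack.gap_nonneg ν a)
  rw [Quack.groupRegret, ← Finset.sum_subset (Finset.subset_univ (Quack.subopt ν))
    fun a _ ha => by rw [hopt a ha, zero_mul], Finset.mul_sum, ← Finset.sum_add_distrib,
    Finset.mul_sum]
  exact Finset.sum_le_sum fun a ha =>
    Quack.gap_mul_integral_plays_le hX hG hπm hπ hε hε1 hν hmn (Quack.mem_subopt.1 ha)

theorem mainTheorem3 (ε : ℝ) (hε : 0 < ε) (hε1 : ε ≤ 1) :
    ∃ C : ℝ, 0 < C ∧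
      ∀ (Ω : Type*) [MeasurableSpace Ω] (P : Measure Ω) [IsProbabilityMeasure P]
        (m k n : ℕ) (_hmn : 2 ≤ m * n)
        (G : SimpleGraph (Fin m)) (_hG : G.Connected) (v : Fin m)
        (σ : ℝ) (ν : Fin k → Measure ℝ) [∀ a, IsProbabilityMeasure (ν a)]
        (_hint : ∀ a, Integrable (fun x : ℝ => |x| ^ (1 + ε)) (ν a))
        (_hmom : ∀ a, ∫ x, |x| ^ (1 + ε) ∂(ν a) ≤ σ)
        (X : ℕ → Fin m → Fin k → Ω → ℝ) (U : ℕ → Fin m → Ω → Fin k)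
        (_hXU : Quack.IsEnvironment P ν X U)
        (π : List (Fin k × ℝ) → Fin k) (_hπm : Quack.MeasurablePolicy π)
        (_hπ : Quack.IsRobustUCB ε σ π),
        Quack.groupRegret P ν X U G v π n ≤
          C * ((∑ a ∈ Quack.subopt ν,
                  σ ^ (1 / ε) * Real.log ((m : ℝ) * n) / Quack.gap ν a ^ (1 / ε))
              + (∑ w, (G.dist v w : ℝ)) * ∑ a ∈ Quack.subopt ν, Quack.gap ν a) := by
  obtain ⟨C, hC, hregret⟩ := mainTheorem3_general ε hε hε1
  exact ⟨C, hC, fun Ω _ P _ m k n hmn G hG v σ ν _ hint hmom X U hXU π hπm hπ =>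
    hregret Ω P m k n hmn G hG v σ ν (fun a => ⟨hint a, hmom a⟩) X U hXU.isRewardModel π hπm hπ⟩
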